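/- For $\alpha,\beta>-1$ let $$P_n^{(\alpha,\beta)}(x)=(1-x)^{-\alpha}(1+x)^{-\beta}\frac{(-1)^n}{2^n n!}\frac{d^n}{dx^n}\Big\{(1-x)^{n+\alpha}(1+x)^{n+\beta}\Big\},\qquad x\in(-1,1),$$ be the Jacobi polynomials and let, for $\theta\in(0,\pi)$, $$\mathcal P_n^{(\alpha,\beta)}(\theta)=\Big(\frac{(2n+\alpha+\beta+1)\,\Gamma(n+1)\,\Gamma(n+\alpha+\beta+1)}{\Gamma(n+\alpha+1)\,\Gamma(n+\beta+1)}\Big)^{1/2}P_n^{(\alpha,\beta)}(\cos\theta)$$ be the trigonometric Jacobi polynomials, which are orthonormal with respect to $d\mu_{\alpha,\beta}(\theta)=(\sin\frac\theta2)^{2\alpha+1}(\cos\frac\theta2)^{2\beta+1}d\theta$ on $(0,\pi)$ and are eigenfunctions, with eigenvalues $(n+\frac{\alpha+\beta+1}2)^2$, of the Jacobi operator $$\mathcal J^{\alpha,\beta}=-\frac{d^2}{d\theta^2}-\frac{\alpha-\beta+(\alpha+\beta+1)\cos\theta}{\sin\theta}\frac{d}{d\theta}+\Big(\frac{\alpha+\beta+1}{2}\Big)^2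 .$$ For $0<\sigma<1$, the kernel of the Jacobi fractional integral $(\mathcal J^{\alpha,\beta})^{-\sigma/2}$ (with respect to $d\mu_{\alpha,\beta}$) is $$\mathcal K_\sigma^{\alpha,\beta}(\theta,\varphi)=\frac1{\Gamma(\sigma)}\int_0^\infty \mathcal P_t^{\alpha,\beta}(\theta,\varphi)\,\frac{dt}{t^{1-\sigma}},\qquad \mathcal P_t^{\alpha,\beta}(\theta,\varphi)=\sum_{n=0}^\infty e^{-t\left|n+\frac{\alpha+\beta+1}2\right|}\,\mathcal P_n^{(\alpha,\beta)}(\theta)\,\mathcal P_n^{(\alpha,\beta)}(\varphi).$$ **Theorem.** Let $0<\sigma<1$. There exists a constant $C_\sigma>0$ that depends only on $\sigma$ such that for all $\alpha\ge-1/2$, all $\beta>-1/2$ and all $\theta,\varphi\in(0,\pi)$ with $\theta\ne\varphi$, the series defining $\mathcal P_t^{\alpha,\beta}(\theta,\varphi)$ converges absolutely for every $t>0$, the integral defining $\mathcal K_\sigma^{\alpha,\beta}(\theta,\varphi)$ converges absolutely, and $$0\le\mathcal K_\sigma^{\alpha,\beta}(\theta,\varphi)\le\frac{C_\sigma}{\left(\sin\frac\theta2\sin\frac\varphi2\right)^{\alpha+1/2}\left(\cos\frac\theta2\cos\frac\varphi2\right)^{\beta+1/2}}\left(\frac1{\beta+1/2}+\frac1{|\sin\frac{\theta-\varphi}4|^{1-\sigma}}\right).$$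 -/

import Mathlib

/-- The standard Jacobi polynomial of degree `n` and type `(α, β)`, given on `(-1, 1)` by
Rodrigues' formula. -/
noncomputable def jacobiP (α β : ℝ) (n : ℕ) (x : ℝ) : ℝ :=
  (1 - x) ^ (-α) * (1 + x) ^ (-β) * ((-1) ^ n / (2 ^ n * (n.factorial : ℝ))) *
    iteratedDeriv n (fun y : ℝ => (1 - y) ^ ((n : ℝ) + α) * (1 + y) ^ ((n : ℝ) + β)) x

/-- The factor that normalizes the trigonometric Jacobi polynomials in `L²((0, π), dμ)`, where
`dμ(θ) = sin(θ/2)^(2α+1) cos(θ/2)^(2β+1) dθ`. -/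
noncomputable def jacobiNorm (α β : ℝ) (n : ℕ) : ℝ :=
  Real.sqrt ((2 * (n : ℝ) + α + β + 1) * Real.Gamma ((n : ℝ) + 1) *
      Real.Gamma ((n : ℝ) + α + β + 1) /
    (Real.Gamma ((n : ℝ) + α + 1) * Real.Gamma ((n : ℝ) + β + 1)))

/-- The normalized trigonometric Jacobi polynomials: the orthonormal eigenfunctions of the Jacobi
operator, with eigenvalues `(n + (α + β + 1) / 2) ^ 2`. -/
noncomputable def trigJacobi (α β : ℝ) (n : ℕ) (θ : ℝ) : ℝ :=
  jacobiNorm α β n * jacobiP α β n (Real.cos θ)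

/-- The `n`-th term of the spectral expansion of the Jacobi-Poisson kernel. -/
noncomputable def jacobiPoissonTerm (α β t θ φ : ℝ) (n : ℕ) : ℝ :=
  Real.exp (-t * |(n : ℝ) + (α + β + 1) / 2|) * trigJacobi α β n θ * trigJacobi α β n φ

/-- The Jacobi-Poisson kernel: the integral kernel of `exp (-t √J)`, `J` the Jacobi operator. -/
noncomputable def jacobiPoissonKernel (α β t θ φ : ℝ) : ℝ :=
  ∑' n : ℕ, jacobiPoissonTerm α β t θ φ n

/-- The kernel of the Jacobi fractional integral `J ^ (-σ/2)`, with respect to the measure `dμ`. -/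
noncomputable def jacobiFractionalKernel (σ α β θ φ : ℝ) : ℝ :=
  1 / Real.Gamma σ * ∫ t in Set.Ioi (0 : ℝ), jacobiPoissonKernel α β t θ φ / t ^ (1 - σ)

/-! Put `a = α + 1`, `b = β + 1`, `x = sin² (θ/2)`, `y = sin² (φ/2)`, `A = sin (θ/2) sin (φ/2)`, `B
= cos (θ/2) cos (φ/2)`, so that `x y = A²`, `(1 - x)(1 - y) = B²` and `A + B = cos ((θ - φ)/2) = 1 -
2 δ²` with `δ = |sin ((θ - φ)/4)|`.

The terms of the spectral series oscillate, so positivity and uniform bounds are invisible there.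
Watson's formula (`shiftedJacobi_mul_shiftedJacobi`) writes a product of two Jacobi polynomials as a
terminating double series in `A²` and `B²`. Inserting it and summing over the degree
(`tsum_poissonCoeff_mul_pow`) turns the Poisson kernel into `tanh (t/2)` times a double series with
nonnegative terms in `z = 1 / cosh (t/2)`.

After multiplication by the weight `A ^ (α + 1/2) * B ^ (β + 1/2)`, duplication and log-convexity of
Gamma compare its coefficients, with a constant free of `α` and `β`, to those of a binomial-type
series whose sum is at most `1 / (1 - z (A + B))` (`sum_watsonPart_le`). The weighted kernel is thus
dominated by a classical Poisson-like kernel in `t` and `δ`. For `t > 2` the lowest power `z ^ (α +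
β + 1)` supplies decay of rate at least `(β + 1/2) / 2`. Integrating against `t ^ (σ - 1)` gives `δ
^ (σ - 1)` from bounded times and `1 / (β + 1/2)` from large times (`exists_integral_div_rpow_le`).
-/

open Polynomial Finset Filter Topology MeasureTheory

/-! ### The hypergeometric operator and uniqueness of its polynomial eigenfunctions -/

/-- The Jacobi differential operator `x (1 - x) f'' + (a - (a + b) x) f'` on polynomials. -/
noncomputable def jacobiDiff (a b : ℝ) (f : ℝ[X]) : ℝ[X] :=
  X * (1 - X) * derivative (derivative f) + (C a - C (a + b) * X) * derivative f

lemma jacobiDiff_add (a b : ℝ) (f g : ℝ[X]) :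
    jacobiDiff a b (f + g) = jacobiDiff a b f + jacobiDiff a b g := by
  simp only [jacobiDiff, derivative_add]; ring

lemma jacobiDiff_C_mul (a b r : ℝ) (f : ℝ[X]) :
    jacobiDiff a b (C r * f) = C r * jacobiDiff a b f := by
  simp only [jacobiDiff, derivative_C_mul]; ring

lemma jacobiDiff_sum {ι : Type*} (a b : ℝ) (s : Finset ι) (f : ι → ℝ[X]) :
    jacobiDiff a b (∑ i ∈ s, f i) = ∑ i ∈ s, jacobiDiff a b (f i) := by
  simp only [jacobiDiff, derivative_sum, mul_sum, sum_add_distrib]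

/-- Comparing coefficients gives a two-term recurrence whose leading factor `(j + 1) (j + a)` never
vanishes for `a > 0`, so the constant term determines everything. The second, singular solution at
`0` is not a polynomial. -/
lemma eq_zero_of_jacobiDiff_eq {a b N : ℝ} (ha : 0 < a) {f : ℝ[X]}
    (hf : jacobiDiff a b f = C (-N) * f) (h0 : f.coeff 0 = 0) : f = 0 := by
  have hrec : ∀ j : ℕ, ((j : ℝ) + 1) * (j + a) * f.coeff (j + 1) =
      (j * (j - 1) + (a + b) * j - N) * f.coeff j := by
    intro j
    have h := congrArg (fun p => p.coeff j) hf
    have e : jacobiDiff a b f = X * derivative (derivative f)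
        - X ^ 2 * derivative (derivative f) + C a * derivative f
        - C (a + b) * (X * derivative f) := by
      simp only [jacobiDiff]; ring
    simp only [e, coeff_add, coeff_sub, coeff_C_mul] at h
    rcases j with _ | _ | j
    · simp [coeff_derivative, pow_two, mul_assoc] at h ⊢; linarith
    · simp [coeff_derivative, pow_two, mul_assoc] at h ⊢; linarith
    · rw [coeff_X_pow_mul', if_pos (by omega)] at h
      simp [coeff_derivative] at h ⊢
      linarith
  ext j
  induction j with
  | zero => simpa using h0
  | succ j ih =>
    have h := hrec j
    rw [ih] at h
    simp only [coeff_zero, mul_zero] at h ⊢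
    have : ((j : ℝ) + 1) * (j + a) ≠ 0 := by positivity
    exact (mul_eq_zero.1 h).resolve_left this

lemma eigenfunction_proportional {a b N : ℝ} (ha : 0 < a) {f g : ℝ[X]}
    (hf : jacobiDiff a b f = C (-N) * f) (hg : jacobiDiff a b g = C (-N) * g) (x : ℝ) :
    g.eval 0 * f.eval x = f.eval 0 * g.eval x := by
  have h : C (g.eval 0) * f + C (-f.eval 0) * g = 0 := by
    refine eq_zero_of_jacobiDiff_eq (b := b) (N := N) ha ?_ ?_
    · rw [jacobiDiff_add, jacobiDiff_C_mul, jacobiDiff_C_mul, hf, hg]; ring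
    · simp [coeff_zero_eq_eval_zero]; ring
  have := congrArg (eval x) h
  simp at this
  linarith

/-- This form lowers the total degree `m + k` by one up to a diagonal term, which suits the Watson
series. The truncated exponents `m - 1` and `k - 1` are harmless, since their coefficients vanish at
`0`. -/
lemma jacobiDiff_X_pow_mul (a b : ℝ) (m k : ℕ) :
    jacobiDiff a b (X ^ m * (1 - X) ^ k) =
      C (m * (m - 1 + a)) * (X ^ (m - 1) * (1 - X) ^ k) +
      C (k * (k - 1 + b)) * (X ^ m * (1 - X) ^ (k - 1)) -
      C ((m + k) * (m + k + (a + b - 1))) * (X ^ m * (1 - X) ^ k) := by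
  rcases m with _ | _ | m <;> rcases k with _ | _ | k <;>
    simp [jacobiDiff, derivative_pow, C_add, C_mul] <;> ring

/-- This form keeps the total degree `m + k` and only moves to neighbouring terms, which suits the
Bernstein-type basis. -/
lemma jacobiDiff_X_pow_mul' (a b : ℝ) (m k : ℕ) :
    jacobiDiff a b (X ^ m * (1 - X) ^ k) =
      C (m * (m - 1 + a)) * (X ^ (m - 1) * (1 - X) ^ (k + 1)) +
      C (k * (k - 1 + b)) * (X ^ (m + 1) * (1 - X) ^ (k - 1)) -
      C (2 * m * k + a * k + b * m) * (X ^ m * (1 - X) ^ k) := by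
  have h2 : (C (2 : ℝ) : ℝ[X]) = 2 := rfl
  rw [jacobiDiff_X_pow_mul]
  rcases m with _ | m <;> rcases k with _ | k <;>
    simp [C_add, C_mul, h2] <;> ring

/-! ### Jacobi polynomials as eigenpolynomials, with their end-point values -/

/-- The coefficients of the Jacobi polynomial in the Bernstein-type basis. -/
noncomputable def jacobiCoeff (a b : ℝ) (n s : ℕ) : ℝ :=
  (-1) ^ s * Real.Gamma (n + a) * Real.Gamma (n + b) /
    (s.factorial * (n - s).factorial * Real.Gamma (s + a) * Real.Gamma ((n - s : ℕ) + b))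

/-- The Jacobi polynomial of type `(a - 1, b - 1)` in the variable `(1 - x) / 2`. -/
noncomputable def shiftedJacobi (a b : ℝ) (n : ℕ) : ℝ[X] :=
  ∑ s ∈ range (n + 1), C (jacobiCoeff a b n s) * (X ^ s * (1 - X) ^ (n - s))

lemma jacobiCoeff_succ {a b : ℝ} (ha : 0 < a) (hb : 0 < b) {n s : ℕ} (hs : s < n) :
    jacobiCoeff a b n (s + 1) * ((s + 1) * (s + a)) =
      -(jacobiCoeff a b n s * (((n - s : ℕ) : ℝ) * ((n - s : ℕ) - 1 + b))) := by
  obtain ⟨k, rfl⟩ := Nat.exists_eq_add_of_lt hs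
  have e1 : s + k + 1 - (s + 1) = k := by omega
  have e2 : s + k + 1 - s = k + 1 := by omega
  simp only [jacobiCoeff, e1, e2]
  have h1 : Real.Gamma ((s + 1 : ℕ) + a) = (s + a) * Real.Gamma (s + a) := by
    rw [← Real.Gamma_add_one (by positivity)]; push_cast; ring_nf
  have h2 : Real.Gamma ((k + 1 : ℕ) + b) = (k + b) * Real.Gamma (k + b) := by
    rw [← Real.Gamma_add_one (by positivity)]; push_cast; ring_nf
  have := (Real.Gamma_pos_of_pos (show 0 < (s : ℝ) + a by positivity)).ne'
  have := (Real.Gamma_pos_of_pos (show 0 < (k : ℝ) + b by positivity)).ne'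
  have : (s : ℝ) + a ≠ 0 := by positivity
  have : (k : ℝ) + b ≠ 0 := by positivity
  rw [h1, h2, Nat.factorial_succ, Nat.factorial_succ, pow_succ]
  have := Nat.factorial_ne_zero s
  have := Nat.factorial_ne_zero k
  push_cast
  field_simp
  ring

lemma jacobiDiff_shiftedJacobi {a b : ℝ} (ha : 0 < a) (hb : 0 < b) (n : ℕ) :
    jacobiDiff a b (shiftedJacobi a b n) = C (-(n * (n + (a + b - 1)))) * shiftedJacobi a b n := by
  rw [shiftedJacobi, jacobiDiff_sum]
  have hd : ∀ u x y z : ℝ[X], u * (x + y - z) = u * x + u * y - u * z := by intros; ring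
  simp only [jacobiDiff_C_mul, jacobiDiff_X_pow_mul', hd, sum_sub_distrib, sum_add_distrib,
    mul_sum]
  -- The two off-diagonal sums are shifted back to the index `s`; the coefficient recurrence then
  -- makes all three contributions multiples of the same basis element.
  have h1 : ∑ s ∈ range (n + 1), C (jacobiCoeff a b n s) *
        (C (s * (s - 1 + a)) * (X ^ (s - 1) * (1 - X) ^ (n - s + 1))) =
      ∑ s ∈ range (n + 1), C (-(jacobiCoeff a b n s * (((n - s : ℕ) : ℝ) * ((n - s : ℕ) - 1 + b))))
        * (X ^ s * (1 - X) ^ (n - s)) := by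
    rw [sum_range_succ', sum_range_succ]
    congr 1
    · refine sum_congr rfl fun s hs => ?_
      have hs' := mem_range.1 hs
      rw [← jacobiCoeff_succ ha hb hs', ← mul_assoc, ← C_mul]
      have e : n - (s + 1) + 1 = n - s := by omega
      rw [e]; simp
    · simp
  have h2 : ∑ s ∈ range (n + 1), C (jacobiCoeff a b n s) *
        (C ((n - s : ℕ) * ((n - s : ℕ) - 1 + b)) * (X ^ (s + 1) * (1 - X) ^ (n - s - 1))) =
      ∑ s ∈ range (n + 1), C (-(jacobiCoeff a b n s * (s * (s - 1 + a))))
        * (X ^ s * (1 - X) ^ (n - s)) := by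
    rw [sum_range_succ, sum_range_succ' _ n]
    congr 1
    · refine sum_congr rfl fun s hs => ?_
      have hs' := mem_range.1 hs
      have := jacobiCoeff_succ ha hb hs'
      have e : n - s - 1 = n - (s + 1) := by omega
      rw [← mul_assoc, ← C_mul, e]
      push_cast
      rw [add_sub_cancel_right, this, neg_neg]
    · simp
  rw [h1, h2, ← sum_add_distrib, ← sum_sub_distrib]
  refine sum_congr rfl fun s hs => ?_
  have hs' : s ≤ n := by have := mem_range.1 hs; omega
  generalize (X ^ s * (1 - X) ^ (n - s) : ℝ[X]) = E
  rw [Nat.cast_sub hs']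
  simp only [← mul_assoc, ← C_mul, ← add_mul, ← sub_mul, ← C_add, ← C_sub]
  congr 2
  ring

lemma shiftedJacobi_eval_zero {a b : ℝ} (hb : 0 < b) (n : ℕ) :
    (shiftedJacobi a b n).eval 0 = Real.Gamma (n + a) / (n.factorial * Real.Gamma a) := by
  rw [shiftedJacobi, eval_finsetSum, sum_range_succ']
  have := (Real.Gamma_pos_of_pos (show 0 < (n : ℝ) + b by positivity)).ne'
  simp [jacobiCoeff]
  field_simp

lemma shiftedJacobi_eval_one {a b : ℝ} (ha : 0 < a) (n : ℕ) :
    (shiftedJacobi a b n).eval 1 = (-1) ^ n * Real.Gamma (n + b) / (n.factorial * Real.Gamma b) := by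
  rw [shiftedJacobi, eval_finsetSum, sum_range_succ, sum_eq_zero]
  · have := (Real.Gamma_pos_of_pos (show 0 < (n : ℝ) + a by positivity)).ne'
    simp [jacobiCoeff]
    field_simp
  · intro s hs
    have hs' := mem_range.1 hs
    simp [show n - s ≠ 0 by omega]

/-! ### Watson's product formula -/

/-- The homogeneous part of degree `s` of the double power series in Watson's product formula,
as a polynomial in its first variable. -/
noncomputable def watsonPart (a b y : ℝ) (s : ℕ) : ℝ[X] :=
  ∑ p ∈ antidiagonal s, C (y ^ p.1 * (1 - y) ^ p.2 /
    (Real.Gamma (a + p.1) * Real.Gamma (b + p.2) * p.1.factorial * p.2.factorial)) *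
      (X ^ p.1 * (1 - X) ^ p.2)

lemma Gamma_add_natCast_succ {a : ℝ} (ha : 0 < a) (m : ℕ) :
    Real.Gamma (a + (m + 1 : ℕ)) = (a + m) * Real.Gamma (a + m) := by
  rw [← Real.Gamma_add_one (by positivity)]; push_cast; ring_nf

lemma jacobiDiff_watsonPart_zero (a b y : ℝ) : jacobiDiff a b (watsonPart a b y 0) = 0 := by
  simp [watsonPart, jacobiDiff]

/-- The Gamma and factorial denominators are chosen so that the factors produced by differentiation
cancel. This makes the parts a ladder on which the operator is bidiagonal. -/
lemma jacobiDiff_watsonPart_succ {a b : ℝ} (ha : 0 < a) (hb : 0 < b) (y : ℝ) (s : ℕ) :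
    jacobiDiff a b (watsonPart a b y (s + 1)) = watsonPart a b y s -
      C (((s + 1 : ℕ) : ℝ) * ((s + 1 : ℕ) + (a + b - 1))) * watsonPart a b y (s + 1) := by
  have hd : ∀ u x y z : ℝ[X], u * (x + y - z) = u * x + u * y - u * z := by intros; ring
  rw [watsonPart, jacobiDiff_sum]
  simp only [jacobiDiff_C_mul, jacobiDiff_X_pow_mul, hd, sum_sub_distrib, sum_add_distrib]
  congr 1
  · rw [Finset.Nat.sum_antidiagonal_succ, Finset.Nat.sum_antidiagonal_succ', watsonPart]
    -- Lowering the exponent of `X` leaves an extra factor `y`, lowering that of `1 - X` an extra `1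
    -- - y`; the two pieces recombine through `y + (1 - y) = 1`.
    have e : ∀ p ∈ antidiagonal s, C (y ^ p.1 * (1 - y) ^ p.2 /
        (Real.Gamma (a + p.1) * Real.Gamma (b + p.2) * p.1.factorial * p.2.factorial)) *
        (X ^ p.1 * (1 - X) ^ p.2) = C (y * (y ^ p.1 * (1 - y) ^ p.2 /
        (Real.Gamma (a + p.1) * Real.Gamma (b + p.2) * p.1.factorial * p.2.factorial))) *
        (X ^ p.1 * (1 - X) ^ p.2) + C ((1 - y) * (y ^ p.1 * (1 - y) ^ p.2 /
        (Real.Gamma (a + p.1) * Real.Gamma (b + p.2) * p.1.factorial * p.2.factorial))) *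
        (X ^ p.1 * (1 - X) ^ p.2) := by
      intro p _
      rw [← add_mul, ← C_add]; congr 2; ring
    rw [sum_congr rfl e, sum_add_distrib]
    congr 1
    · simp only [Nat.cast_zero, zero_mul, C_0, mul_zero, zero_add]
      refine sum_congr rfl fun p _ => ?_
      rw [← mul_assoc, ← C_mul, Gamma_add_natCast_succ ha, Nat.factorial_succ]
      congr 2
      have := (Real.Gamma_pos_of_pos (show 0 < a + p.1 by positivity)).ne'
      have := (Real.Gamma_pos_of_pos (show 0 < b + p.2 by positivity)).ne'
      have : a + (p.1 : ℝ) ≠ 0 := by positivity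
      have := Nat.factorial_ne_zero p.1
      have := Nat.factorial_ne_zero p.2
      push_cast
      field_simp
      ring
    · simp only [Nat.cast_zero, zero_mul, C_0, mul_zero, zero_add]
      refine sum_congr rfl fun p _ => ?_
      rw [← mul_assoc, ← C_mul, Gamma_add_natCast_succ hb, Nat.factorial_succ]
      congr 2
      have := (Real.Gamma_pos_of_pos (show 0 < a + p.1 by positivity)).ne'
      have := (Real.Gamma_pos_of_pos (show 0 < b + p.2 by positivity)).ne'
      have : b + (p.2 : ℝ) ≠ 0 := by positivity
      have := Nat.factorial_ne_zero p.1
      have := Nat.factorial_ne_zero p.2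
      push_cast
      field_simp
      ring
  · rw [mul_sum]
    refine sum_congr rfl fun p hp => ?_
    rw [← mem_antidiagonal.1 hp]
    push_cast
    ring

/-- The coefficients of Watson's product formula. -/
noncomputable def watsonCoeff (l : ℝ) (n s : ℕ) : ℝ :=
  (-1) ^ s * Real.Gamma (n + l + s) * n.descFactorial s

/-- With `l = a + b - 1`, the factor equals `s (s + l) - n (n + l)`, exactly what the bidiagonal
action needs to produce the eigenvalue `-n (n + l)`. -/
lemma watsonCoeff_succ {l : ℝ} (hl : 0 < l) (n s : ℕ) :
    watsonCoeff l n (s + 1) = (s - n) * (s + n + l) * watsonCoeff l n s := by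
  rw [watsonCoeff, watsonCoeff, Nat.descFactorial_succ, Gamma_add_natCast_succ (by positivity),
    pow_succ]
  rcases le_or_gt s n with h | h
  · rw [Nat.cast_mul, Nat.cast_sub h]; ring
  · simp [Nat.descFactorial_of_lt h]

/-- The terminating double series in Watson's product formula. -/
noncomputable def watsonSum (a b y : ℝ) (n : ℕ) : ℝ[X] :=
  ∑ s ∈ range (n + 1), C (watsonCoeff (a + b - 1) n s) * watsonPart a b y s

lemma jacobiDiff_watsonSum {a b : ℝ} (ha : 0 < a) (hb : 0 < b) (hab : 1 < a + b) (y : ℝ) (n : ℕ) :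
    jacobiDiff a b (watsonSum a b y n) =
      C (-(n * (n + (a + b - 1)))) * watsonSum a b y n := by
  have hl : 0 < a + b - 1 := by linarith
  have key : ∀ s, jacobiDiff a b (C (watsonCoeff (a + b - 1) n (s + 1)) * watsonPart a b y (s + 1))
      = C (watsonCoeff (a + b - 1) n (s + 1)) * watsonPart a b y s
        - C (((s + 1 : ℕ) : ℝ) * ((s + 1 : ℕ) + (a + b - 1))) *
          (C (watsonCoeff (a + b - 1) n (s + 1)) * watsonPart a b y (s + 1)) := by
    intro s
    rw [jacobiDiff_C_mul, jacobiDiff_watsonPart_succ ha hb]; ring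
  rw [watsonSum, jacobiDiff_sum, sum_range_succ', jacobiDiff_C_mul, jacobiDiff_watsonPart_zero]
  simp only [key, sum_sub_distrib, mul_zero, add_zero]
  -- The added term `s = n` is zero because the recurrence factor `s - n` vanishes there: the series
  -- terminates.
  have h1 : ∑ s ∈ range n, C (watsonCoeff (a + b - 1) n (s + 1)) * watsonPart a b y s =
      ∑ s ∈ range (n + 1), C (watsonCoeff (a + b - 1) n (s + 1)) * watsonPart a b y s := by
    rw [sum_range_succ, watsonCoeff_succ hl n n]; simp
  have h2 : ∑ s ∈ range n, C (((s + 1 : ℕ) : ℝ) * ((s + 1 : ℕ) + (a + b - 1))) *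
        (C (watsonCoeff (a + b - 1) n (s + 1)) * watsonPart a b y (s + 1)) =
      ∑ s ∈ range (n + 1), C ((s : ℝ) * (s + (a + b - 1))) *
        (C (watsonCoeff (a + b - 1) n s) * watsonPart a b y s) := by
    rw [sum_range_succ']; simp
  rw [h1, h2, ← sum_sub_distrib, mul_sum]
  refine sum_congr rfl fun s _ => ?_
  rw [← mul_assoc, ← mul_assoc, ← sub_mul, ← C_mul, ← C_sub, ← C_mul, watsonCoeff_succ hl]
  congr 2
  ring

lemma watsonPart_comm (a b x y : ℝ) (s : ℕ) :
    (watsonPart a b y s).eval x = (watsonPart a b x s).eval y := by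
  simp only [watsonPart, eval_finsetSum]
  refine sum_congr rfl fun p _ => ?_
  simp; ring

lemma watsonSum_comm (a b x y : ℝ) (n : ℕ) :
    (watsonSum a b y n).eval x = (watsonSum a b x n).eval y := by
  simp only [watsonSum, eval_finsetSum, eval_mul, eval_C, watsonPart_comm a b x y]

lemma watsonPart_nonneg {a b x y : ℝ} (ha : 0 < a) (hb : 0 < b) (hx : x ∈ Set.Icc (0 : ℝ) 1)
    (hy : y ∈ Set.Icc (0 : ℝ) 1) (s : ℕ) : 0 ≤ (watsonPart a b y s).eval x := by
  have := sub_nonneg.2 hx.2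
  have := sub_nonneg.2 hy.2
  have := hx.1
  have := hy.1
  rw [watsonPart, eval_finsetSum]
  refine sum_nonneg fun p _ => ?_
  have := (Real.Gamma_pos_of_pos (show 0 < a + p.1 by positivity))
  have := (Real.Gamma_pos_of_pos (show 0 < b + p.2 by positivity))
  simp
  positivity

/-- At the corner `(0, 1)` both `x y` and `(1 - x) (1 - y)` vanish, so only degree zero survives.
This fixes the constant in Watson's formula. -/
lemma watsonPart_one_eval_zero (a b : ℝ) (s : ℕ) :
    (watsonPart a b 1 s).eval 0 = if s = 0 then 1 / (Real.Gamma a * Real.Gamma b) else 0 := by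
  split_ifs with h
  · subst h; simp [watsonPart]
  · rw [watsonPart, eval_finsetSum]
    refine sum_eq_zero fun p hp => ?_
    have hp' := mem_antidiagonal.1 hp
    rcases Nat.eq_zero_or_pos p.1 with h1 | h1
    · have : p.2 ≠ 0 := by omega
      simp [this]
    · simp [h1.ne']

lemma watsonSum_one_eval_zero (a b : ℝ) (n : ℕ) : (watsonSum a b 1 n).eval 0 =
    Real.Gamma (n + (a + b - 1)) / (Real.Gamma a * Real.Gamma b) := by
  rw [watsonSum, eval_finsetSum, sum_range_succ', sum_eq_zero]
  · simp [watsonPart_one_eval_zero, watsonCoeff]; ring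
  · intro s _
    simp [watsonPart_one_eval_zero]

/-- **Watson's product formula** for Jacobi polynomials. -/
theorem shiftedJacobi_mul_shiftedJacobi {a b : ℝ} (ha : 0 < a) (hb : 0 < b) (hab : 1 < a + b)
    (n : ℕ) (x y : ℝ) :
    Real.Gamma (n + (a + b - 1)) * ((shiftedJacobi a b n).eval x * (shiftedJacobi a b n).eval y) =
      (-1) ^ n * Real.Gamma (n + a) * Real.Gamma (n + b) / (n.factorial : ℝ) ^ 2 *
        (watsonSum a b y n).eval x := by
  have hP := jacobiDiff_shiftedJacobi ha hb n
  have hx : ∀ x y, (shiftedJacobi a b n).eval 0 * (watsonSum a b y n).eval x =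
      (watsonSum a b y n).eval 0 * (shiftedJacobi a b n).eval x := fun x y =>
    eigenfunction_proportional ha (jacobiDiff_watsonSum ha hb hab y n) hP x
  -- Proportionality in `x`, then in `y` by symmetry, separates the variables. The remaining
  -- constant, the value at `(0, 0)`, is eliminated below by comparison with the corner `(0, 1)`.
  have hxy : ∀ x y, (shiftedJacobi a b n).eval 0 ^ 2 * (watsonSum a b y n).eval x =
      (watsonSum a b 0 n).eval 0 * (shiftedJacobi a b n).eval x * (shiftedJacobi a b n).eval y := by
    intro x y
    have h1 := hx x y
    have h2 := hx y 0
    rw [watsonSum_comm a b y 0] at h2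
    linear_combination (shiftedJacobi a b n).eval 0 * h1 + (shiftedJacobi a b n).eval x * h2
  have h1 := hxy 0 1
  have h2 := hxy x y
  have h0 : (shiftedJacobi a b n).eval 0 ≠ 0 := by
    rw [shiftedJacobi_eval_zero hb]
    have := (Real.Gamma_pos_of_pos (show 0 < (n : ℝ) + a by positivity))
    have := Real.Gamma_pos_of_pos ha
    positivity
  have h3 : (watsonSum a b 1 n).eval 0 *
        ((shiftedJacobi a b n).eval x * (shiftedJacobi a b n).eval y) =
      (shiftedJacobi a b n).eval 0 * (shiftedJacobi a b n).eval 1 * (watsonSum a b y n).eval x := by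
    apply mul_left_cancel₀ (pow_ne_zero 2 h0)
    linear_combination (shiftedJacobi a b n).eval x * (shiftedJacobi a b n).eval y * h1
      - (shiftedJacobi a b n).eval 0 * (shiftedJacobi a b n).eval 1 * h2
  rw [watsonSum_one_eval_zero, shiftedJacobi_eval_zero hb, shiftedJacobi_eval_one ha] at h3
  have := (Real.Gamma_pos_of_pos ha).ne'
  have := (Real.Gamma_pos_of_pos hb).ne'
  have := Nat.factorial_ne_zero n
  field_simp at h3 ⊢
  linear_combination h3

/-- A Sonin-type bound: on `[0, 1]` the square of an eigenpolynomial of the Jacobi operator is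
dominated by its values at the end points. -/
lemma sq_eval_le_of_jacobiDiff_eq {a b N : ℝ} (hab : 1 < a + b) (hN : 0 < N) {f : ℝ[X]}
    (hf : jacobiDiff a b f = C (-N) * f) {x : ℝ} (hx : x ∈ Set.Icc (0 : ℝ) 1) :
    f.eval x ^ 2 ≤ f.eval 0 ^ 2 + f.eval 1 ^ 2 := by
  -- By the differential equation, `g'` is a nonnegative square times an increasing affine function.
  -- Hence `g` first decreases and then increases, and its maximum is at an end point, where the
  -- derivative term of `g` vanishes.
  set g : ℝ[X] := C N * f ^ 2 + X * (1 - X) * derivative f ^ 2 with hg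
  have hg0 : g.eval 0 = N * f.eval 0 ^ 2 := by simp [hg]
  have hg1 : g.eval 1 = N * f.eval 1 ^ 2 := by simp [hg]
  have hgx : N * f.eval x ^ 2 ≤ g.eval x := by
    have := mul_nonneg (mul_nonneg hx.1 (sub_nonneg.2 hx.2)) (sq_nonneg ((derivative f).eval x))
    simp [hg]; linarith
  have hd : ∀ u, (derivative g).eval u =
      2 * (derivative f).eval u ^ 2 * ((a + b - 1) * u - (a - 1 / 2)) := by
    intro u
    have h := congrArg (eval u) hf
    simp [jacobiDiff] at h
    simp [hg, derivative_pow]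
    linear_combination 2 * (derivative f).eval u * h
  have hdiff : ∀ u, HasDerivAt (fun u => g.eval u) ((derivative g).eval u) u :=
    fun u => g.hasDerivAt u
  have hl : 0 < a + b - 1 := by linarith
  suffices h : g.eval x ≤ g.eval 0 ∨ g.eval x ≤ g.eval 1 by
    have h0 := mul_nonneg hN.le (sq_nonneg (f.eval 0))
    have h1 := mul_nonneg hN.le (sq_nonneg (f.eval 1))
    refine le_of_mul_le_mul_left ?_ hN
    rw [mul_add]
    rcases h with h | h <;> linarith
  rcases le_total ((a + b - 1) * x) (a - 1 / 2) with h | h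
  · left
    refine antitoneOn_of_deriv_nonpos (convex_Icc 0 x) g.continuous.continuousOn
      g.differentiable.differentiableOn ?_ ⟨le_rfl, hx.1⟩ ⟨hx.1, le_rfl⟩ hx.1
    intro u hu
    rw [interior_Icc] at hu
    rw [(hdiff u).deriv, hd]
    have := mul_le_mul_of_nonneg_left hu.2.le hl.le
    exact mul_nonpos_of_nonneg_of_nonpos (by positivity) (by linarith)
  · right
    refine monotoneOn_of_deriv_nonneg (convex_Icc x 1) g.continuous.continuousOn
      g.differentiable.differentiableOn ?_ ⟨le_rfl, hx.2⟩ ⟨hx.2, le_rfl⟩ hx.2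
    intro u hu
    rw [interior_Icc] at hu
    rw [(hdiff u).deriv, hd]
    have := mul_le_mul_of_nonneg_left hu.1.le hl.le
    exact mul_nonneg (by positivity) (by linarith)

/-! ### From Rodrigues' formula to the Bernstein-type expansion -/

lemma iteratedDeriv_one_add_rpow {p : ℝ} (n : ℕ) {x : ℝ} (hx : 0 < 1 + x) :
    iteratedDeriv n (fun y : ℝ => (1 + y) ^ p) x =
      (∏ j ∈ range n, (p - j)) * (1 + x) ^ (p - n) := by
  induction n generalizing x with
  | zero => simp
  | succ n ih =>
    rw [iteratedDeriv_succ]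
    have h : (iteratedDeriv n fun y : ℝ => (1 + y) ^ p) =ᶠ[nhds x]
        fun y => (∏ j ∈ range n, (p - j)) * (1 + y) ^ (p - n) := by
      have : ∀ᶠ y in nhds x, 0 < 1 + y :=
        (continuous_const.add continuous_id).continuousAt.eventually (lt_mem_nhds hx)
      filter_upwards [this] with y hy using ih hy
    rw [h.deriv_eq]
    have h2 := (((hasDerivAt_id x).const_add 1).rpow_const (p := p - n)
      (Or.inl hx.ne')).const_mul (∏ j ∈ range n, (p - j))
    simp only [id] at h2
    rw [h2.deriv, prod_range_succ]
    push_cast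
    rw [sub_sub]
    ring

lemma iteratedDeriv_one_sub_rpow {p : ℝ} (n : ℕ) {x : ℝ} (hx : 0 < 1 - x) :
    iteratedDeriv n (fun y : ℝ => (1 - y) ^ p) x =
      (-1) ^ n * (∏ j ∈ range n, (p - j)) * (1 - x) ^ (p - n) := by
  have h := iteratedDeriv_comp_neg n (fun y : ℝ => (1 + y) ^ p) x
  simp only [← sub_eq_add_neg] at h
  rw [h, iteratedDeriv_one_add_rpow n (by simpa [← sub_eq_add_neg] using hx)]
  simp [← sub_eq_add_neg, mul_assoc]

lemma prod_range_sub_mul_Gamma {a : ℝ} (ha : 0 < a) {n j : ℕ} (hj : j ≤ n) :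
    (∏ i ∈ range j, ((n : ℝ) + (a - 1) - i)) * Real.Gamma ((n - j : ℕ) + a) =
      Real.Gamma (n + a) := by
  induction j with
  | zero => simp
  | succ j ih =>
    rw [← ih (by omega), prod_range_succ]
    have e : ((n - j : ℕ) : ℝ) + a = ((n - (j + 1) : ℕ) + a) + 1 := by
      have : n - j = n - (j + 1) + 1 := by omega
      rw [this]; push_cast; ring
    rw [e, Real.Gamma_add_one (by positivity), Nat.cast_sub hj]
    push_cast
    ring

/-- Rodrigues' formula in explicit form. -/
lemma jacobiP_eq_eval {α β : ℝ} (hα : -1 < α) (hβ : -1 < β) (n : ℕ) {x : ℝ}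
    (hx : x ∈ Set.Ioo (-1 : ℝ) 1) :
    jacobiP α β n x = (shiftedJacobi (α + 1) (β + 1) n).eval ((1 - x) / 2) := by
  have h1 : 0 < 1 - x := by linarith [hx.2]
  have h2 : 0 < 1 + x := by linarith [hx.1]
  rw [jacobiP]
  have hc1 : ContDiffAt ℝ n (fun y : ℝ => (1 - y) ^ ((n : ℝ) + α)) x :=
    (contDiffAt_const.sub contDiffAt_id).rpow_const_of_ne h1.ne'
  have hc2 : ContDiffAt ℝ n (fun y : ℝ => (1 + y) ^ ((n : ℝ) + β)) x :=
    (contDiffAt_const.add contDiffAt_id).rpow_const_of_ne h2.ne'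
  -- The sum is reversed because the power `s` of `1 - x` survives when `n - s` derivatives fall on
  -- that factor.
  rw [iteratedDeriv_fun_mul hc1 hc2, shiftedJacobi, eval_finsetSum, ← sum_flip, mul_sum]
  refine sum_congr rfl fun s hs => ?_
  obtain ⟨i, rfl⟩ := Nat.exists_eq_add_of_le' (Nat.lt_succ_iff.1 (mem_range.1 hs))
  have e1 : i + s - i = s := by omega
  have e2 : i + s - s = i := by omega
  rw [iteratedDeriv_one_sub_rpow _ h1, iteratedDeriv_one_add_rpow _ h2]
  have g1 := prod_range_sub_mul_Gamma (show 0 < α + 1 by linarith) (show i ≤ i + s by omega)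
  have g2 := prod_range_sub_mul_Gamma (show 0 < β + 1 by linarith) (show s ≤ i + s by omega)
  have p1 : (1 - x) ^ (-α) * (1 - x) ^ (((i + s : ℕ) : ℝ) + α - i) = (1 - x) ^ s := by
    rw [← Real.rpow_add h1, ← Real.rpow_natCast]; congr 1; push_cast; ring
  have p2 : (1 + x) ^ (-β) * (1 + x) ^ (((i + s : ℕ) : ℝ) + β - s) = (1 + x) ^ i := by
    rw [← Real.rpow_add h2, ← Real.rpow_natCast]; congr 1; push_cast; ring
  have e3 : 1 - (1 - x) / 2 = (1 + x) / 2 := by ring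
  simp only [add_sub_cancel_right, e1, e2] at g1 g2
  simp only [e1, e2, jacobiCoeff, eval_mul, eval_C, eval_pow, eval_X, eval_sub, eval_one, e3,
    div_pow]
  rw [← g1, ← g2, Nat.cast_choose ℝ (show i ≤ i + s by omega), e1, ← p1, ← p2]
  have := (Real.Gamma_pos_of_pos (show 0 < (s : ℝ) + (α + 1) by
    have := s.cast_nonneg (α := ℝ); linarith)).ne'
  have := (Real.Gamma_pos_of_pos (show 0 < (i : ℝ) + (β + 1) by
    have := i.cast_nonneg (α := ℝ); linarith)).ne'
  have h4 : ((-1 : ℝ)) ^ i * (-1) ^ i = 1 := by rw [← mul_pow]; norm_num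
  rw [pow_add (-1 : ℝ), pow_add (2 : ℝ)]
  field_simp
  linear_combination (∏ j ∈ range i, (((i + s : ℕ) : ℝ) + α - j)) *
    (∏ j ∈ range s, (((i + s : ℕ) : ℝ) + β - j)) * h4

/-! ### Power series tools -/

lemma analyticOnNhd_tsum_mul_pow {c : ℕ → ℝ} {R : ℝ}
    (h : ∀ x ∈ Set.Ioo 0 R, Summable fun n => c n * x ^ n) :
    AnalyticOnNhd ℝ (fun x => ∑' n, c n * x ^ n) (Set.Ioo 0 R) := by
  intro x hx
  obtain ⟨ρ, h1, h2⟩ := exists_between hx.2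
  have hρ : 0 < ρ := hx.1.trans h1
  set p := FormalMultilinearSeries.ofScalars ℝ c with hp
  have hrad : (ρ.toNNReal : ENNReal) ≤ p.radius := by
    refine p.le_radius_of_tendsto (l := 0) ?_
    have := (h ρ ⟨hρ, h2⟩).tendsto_atTop_zero.norm
    simpa [hp, FormalMultilinearSeries.ofScalars_norm, Real.coe_toNNReal _ hρ.le, norm_mul,
      abs_of_pos hρ] using this
  have hpos : 0 < p.radius := lt_of_lt_of_le (by simpa using hρ) hrad
  have hb := p.hasFPowerSeriesOnBall hpos
  have he : p.sum = fun x => ∑' n, c n * x ^ n := by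
    funext z
    simp [FormalMultilinearSeries.sum, hp, mul_comm]
  rw [he] at hb
  refine hb.analyticAt_of_mem ?_
  rw [Metric.mem_eball, edist_zero_right]
  refine lt_of_lt_of_le ?_ hrad
  rw [Real.enorm_eq_ofReal hx.1.le]
  exact (ENNReal.ofReal_lt_ofReal_iff hρ).2 h1

lemma hasSum_Gamma_mul_pow {μ x : ℝ} (hμ : 0 < μ) (hx : |x| < 1) :
    HasSum (fun i : ℕ => Real.Gamma (μ + i) / i.factorial * x ^ i)
      (Real.Gamma μ * (1 - x) ^ (-μ)) := by
  have h := (Real.one_div_one_sub_rpow_hasFPowerSeriesOnBall_zero μ).hasSum (y := x)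
    (by rw [Metric.mem_eball, edist_zero_right]
        rw [← ofReal_norm]
        simpa using hx)
  simp only [zero_add, FormalMultilinearSeries.ofScalars_apply_eq, smul_eq_mul] at h
  have hG := Real.Gamma_pos_of_pos hμ
  have hc : ∀ i : ℕ, Real.Gamma μ * Ring.choose (μ + i - 1) i = Real.Gamma (μ + i) / i.factorial := by
    intro i
    have e : (i.factorial : ℝ) * Ring.choose (μ + i - 1) i = (ascPochhammer ℝ i).eval μ := by
      have := Ring.factorial_nsmul_multichoose_eq_ascPochhammer μ i
      rw [Polynomial.ascPochhammer_smeval_eq_eval] at this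
      rw [← this, Ring.choose, nsmul_eq_mul]
      congr 2; ring
    have e2 : Real.Gamma μ * (ascPochhammer ℝ i).eval μ = Real.Gamma (μ + i) := by
      clear e
      induction i with
      | zero => simp
      | succ i ih =>
        rw [ascPochhammer_succ_eval, ← mul_assoc, ih, Gamma_add_natCast_succ hμ]; ring
    have := Nat.factorial_ne_zero i
    rw [← e2, ← e]
    field_simp
  have h' := h.mul_left (Real.Gamma μ)
  have hf : (fun i : ℕ => Real.Gamma (μ + i) / i.factorial * x ^ i) =
      fun i : ℕ => Real.Gamma μ * (Ring.choose (μ + i - 1) i * x ^ i) := by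
    funext i; rw [← hc]; ring
  rw [Real.rpow_neg (by linarith [(abs_lt.1 hx).2]), ← one_div, hf]
  exact h'

/-- The linear factor comes from the normalization of the Jacobi polynomials. Writing `(2 i + μ) Γ(μ
+ i)` as `2 Γ(μ + 1 + i) - μ Γ(μ + i)` reduces the sum to two binomial series. -/
lemma hasSum_linear_mul_Gamma_mul_pow {μ x : ℝ} (hμ : 0 < μ) (hx : |x| < 1) :
    HasSum (fun i : ℕ => (2 * i + μ) * Real.Gamma (μ + i) / i.factorial * x ^ i)
      (Real.Gamma (μ + 1) * ((1 + x) * (1 - x) ^ (-μ - 1))) := by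
  have h1 := (hasSum_Gamma_mul_pow (show 0 < μ + 1 by positivity) hx).mul_left 2
  have h2 := (hasSum_Gamma_mul_pow hμ hx).mul_left μ
  have h1x : 0 < 1 - x := by linarith [(abs_lt.1 hx).2]
  have hf : (fun i : ℕ => (2 * i + μ) * Real.Gamma (μ + i) / i.factorial * x ^ i) =
      fun i : ℕ => 2 * (Real.Gamma (μ + 1 + i) / i.factorial * x ^ i) -
        μ * (Real.Gamma (μ + i) / i.factorial * x ^ i) := by
    funext i
    have : Real.Gamma (μ + 1 + i) = (μ + i) * Real.Gamma (μ + i) := by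
      rw [← Real.Gamma_add_one (by positivity)]; ring_nf
    rw [this]; ring
  have hs : Real.Gamma (μ + 1) * ((1 + x) * (1 - x) ^ (-μ - 1)) =
      2 * (Real.Gamma (μ + 1) * (1 - x) ^ (-(μ + 1))) - μ * (Real.Gamma μ * (1 - x) ^ (-μ)) := by
    have : (1 - x) ^ (-μ) = (1 - x) * (1 - x) ^ (-μ - 1) := by
      rw [Real.rpow_sub h1x, Real.rpow_one]; field_simp
    rw [this, Real.Gamma_add_one hμ.ne', neg_add']; ring
  rw [hf, hs]
  exact h1.sub h2

lemma hasSum_antidiagonal {f : ℕ × ℕ → ℝ} {S : ℝ} (h : HasSum f S) :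
    HasSum (fun n => ∑ p ∈ antidiagonal n, f p) S := by
  have h' := (Finset.HasAntidiagonal.sigmaAntidiagonalEquivProd (A := ℕ)).hasSum_iff.2 h
  refine (h'.sigma fun n => ?_)
  rw [← Finset.sum_coe_sort]
  exact hasSum_fintype _

/-! ### Summing the spectral expansion of the Poisson kernel -/

/-- The coefficients of the power series in `exp (-t)` of the Jacobi-Poisson kernel. -/
noncomputable def poissonCoeff (a b x y : ℝ) (n : ℕ) : ℝ :=
  (2 * n + (a + b - 1)) * Real.Gamma (n + 1) * Real.Gamma (n + (a + b - 1)) /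
    (Real.Gamma (n + a) * Real.Gamma (n + b)) *
      ((shiftedJacobi a b n).eval x * (shiftedJacobi a b n).eval y)

/-- Watson's formula with `n = s + i` makes the coefficient a convolution, so that for fixed `s` the
sum over `i` is explicit. The signs `(-1) ^ n` and `(-1) ^ s` leave `(-1) ^ i`. -/
lemma poissonCoeff_eq {a b : ℝ} (ha : 0 < a) (hb : 0 < b) (hab : 1 < a + b) (x y : ℝ) (n : ℕ) :
    poissonCoeff a b x y n = ∑ p ∈ antidiagonal n, (watsonPart a b y p.1).eval x *
      ((2 * p.2 + (a + b - 1 + 2 * p.1)) * Real.Gamma (a + b - 1 + 2 * p.1 + p.2) /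
        p.2.factorial * (-1) ^ p.2) := by
  have hl : 0 < a + b - 1 := by linarith
  have h := shiftedJacobi_mul_shiftedJacobi ha hb hab n x y
  have := (Real.Gamma_pos_of_pos (show 0 < (n : ℝ) + a by positivity)).ne'
  have := (Real.Gamma_pos_of_pos (show 0 < (n : ℝ) + b by positivity)).ne'
  have h2 : poissonCoeff a b x y n =
      (-1) ^ n * (2 * n + (a + b - 1)) / n.factorial * (watsonSum a b y n).eval x := by
    have := Nat.factorial_ne_zero n
    calc poissonCoeff a b x y n = (2 * n + (a + b - 1)) * n.factorial /
          (Real.Gamma (n + a) * Real.Gamma (n + b)) * (Real.Gamma (n + (a + b - 1)) *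
            ((shiftedJacobi a b n).eval x * (shiftedJacobi a b n).eval y)) := by
          rw [poissonCoeff, Real.Gamma_nat_eq_factorial]; ring
      _ = _ := by rw [h]; field_simp
  rw [h2, Finset.Nat.sum_antidiagonal_eq_sum_range_succ_mk, watsonSum, eval_finsetSum, mul_sum]
  refine sum_congr rfl fun s hs => ?_
  obtain ⟨i, rfl⟩ := Nat.exists_eq_add_of_le (Nat.lt_succ_iff.1 (mem_range.1 hs))
  have e1 : s + i - s = i := by omega
  have hf := Nat.factorial_mul_descFactorial (show s ≤ s + i by omega)
  rw [e1] at hf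
  have hf' : ((s + i).descFactorial s : ℝ) = (s + i).factorial / i.factorial := by
    rw [← hf]; push_cast; field_simp
  have h4 : ((-1 : ℝ)) ^ s * (-1) ^ s = 1 := by rw [← mul_pow]; norm_num
  have e5 : ((s + i : ℕ) : ℝ) + (a + b - 1) + s = a + b - 1 + 2 * s + i := by push_cast; ring
  simp only [e1, watsonCoeff, eval_mul, eval_C, hf', e5, pow_add]
  have := Nat.factorial_ne_zero (s + i)
  have := Nat.factorial_ne_zero i
  field_simp
  push_cast
  linear_combination (2 * (s + (i : ℝ)) + (a + b - 1)) * (watsonPart a b y s).eval x * h4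

lemma summable_Gamma_ratio_mul_pow {a b r : ℝ} (ha : 0 < a) (hb : 0 < b) (hab : 1 < a + b)
    (hr0 : 0 < r) (hr1 : r < 1) :
    Summable fun n : ℕ => (2 * n + (a + b - 1)) * Real.Gamma (n + (a + b - 1)) *
      Real.Gamma (n + a) / (n.factorial * Real.Gamma (n + b)) * r ^ n := by
  have hl : 0 < a + b - 1 := by linarith
  set l := a + b - 1
  have hpos : ∀ n : ℕ, 0 < (2 * n + l) * Real.Gamma (n + l) *
      Real.Gamma (n + a) / (n.factorial * Real.Gamma (n + b)) * r ^ n := by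
    intro n
    have := Real.Gamma_pos_of_pos (show 0 < (n : ℝ) + a by positivity)
    have := Real.Gamma_pos_of_pos (show 0 < (n : ℝ) + b by positivity)
    have := Real.Gamma_pos_of_pos (show 0 < (n : ℝ) + l by positivity)
    positivity
  refine summable_of_ratio_test_tendsto_lt_one hr1 (.of_forall fun n => (hpos n).ne') ?_
  have h1 := tendsto_add_mul_div_add_mul_atTop_nhds (𝕜 := ℝ) (2 + l) l 2 two_ne_zero
  have h2 := tendsto_add_mul_div_add_mul_atTop_nhds (𝕜 := ℝ) l 1 1 one_ne_zero
  have h3 := tendsto_add_mul_div_add_mul_atTop_nhds (𝕜 := ℝ) a b 1 one_ne_zero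
  have h := ((h1.mul h2).mul h3).mul_const r
  simp only [div_self (two_ne_zero : (2 : ℝ) ≠ 0), div_one, one_mul] at h
  refine h.congr fun n => ?_
  rw [Real.norm_of_nonneg (hpos _).le, Real.norm_of_nonneg (hpos _).le]
  have hg : ∀ c : ℝ, 0 < c → Real.Gamma ((n + 1 : ℕ) + c) = (n + c) * Real.Gamma (n + c) := by
    intro c hc
    rw [← Real.Gamma_add_one (by positivity)]; push_cast; ring_nf
  rw [hg l hl, hg a ha, hg b hb, Nat.factorial_succ, pow_succ]
  have := (Real.Gamma_pos_of_pos (show 0 < (n : ℝ) + a by positivity)).ne'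
  have := (Real.Gamma_pos_of_pos (show 0 < (n : ℝ) + b by positivity)).ne'
  have := (Real.Gamma_pos_of_pos (show 0 < (n : ℝ) + l by positivity)).ne'
  have := Nat.factorial_ne_zero n
  have : l + 2 * (n : ℝ) ≠ 0 := by positivity
  have : 2 * (n : ℝ) + l ≠ 0 := by positivity
  have : b + 1 * (n : ℝ) ≠ 0 := by positivity
  have : (n : ℝ) + b ≠ 0 := by positivity
  push_cast
  field_simp
  ring

lemma summable_poissonCoeff_mul_pow {a b x y r : ℝ} (ha : 0 < a) (hb : 0 < b) (hab : 1 < a + b)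
    (hx : x ∈ Set.Icc (0 : ℝ) 1) (hy : y ∈ Set.Icc (0 : ℝ) 1) (hr0 : 0 < r) (hr1 : r < 1) :
    Summable fun n => poissonCoeff a b x y n * r ^ n := by
  have s1 := (summable_Gamma_ratio_mul_pow ha hb hab hr0 hr1).mul_right (1 / Real.Gamma a ^ 2)
  have s2 := (summable_Gamma_ratio_mul_pow hb ha (by linarith) hr0 hr1).mul_right
    (1 / Real.Gamma b ^ 2)
  refine Summable.of_norm_bounded_eventually_nat (s1.add s2) ?_
  -- The end-point bound needs a positive eigenvalue, which excludes `n = 0`.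
  filter_upwards [eventually_ge_atTop 1] with n hn
  have hn0 : (0 : ℝ) < n := by exact_mod_cast hn
  have hl : 0 < a + b - 1 := by linarith
  have hN : 0 < (n : ℝ) * (n + (a + b - 1)) := by positivity
  have hP := jacobiDiff_shiftedJacobi ha hb n
  have h1 := sq_eval_le_of_jacobiDiff_eq hab hN hP hx
  have h2 := sq_eval_le_of_jacobiDiff_eq hab hN hP hy
  have g0 := Real.Gamma_pos_of_pos ha
  have g1 := Real.Gamma_pos_of_pos hb
  have g2 := Real.Gamma_pos_of_pos (show 0 < (n : ℝ) + a by positivity)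
  have g3 := Real.Gamma_pos_of_pos (show 0 < (n : ℝ) + b by positivity)
  have g4 := Real.Gamma_pos_of_pos (show 0 < (n : ℝ) + (a + b - 1) by positivity)
  have hPP : |(shiftedJacobi a b n).eval x * (shiftedJacobi a b n).eval y| ≤
      (shiftedJacobi a b n).eval 0 ^ 2 + (shiftedJacobi a b n).eval 1 ^ 2 := by
    rw [abs_le]
    constructor
    · nlinarith [sq_nonneg ((shiftedJacobi a b n).eval x + (shiftedJacobi a b n).eval y)]
    · nlinarith [sq_nonneg ((shiftedJacobi a b n).eval x - (shiftedJacobi a b n).eval y)]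
  have hk : 0 < (2 * n + (a + b - 1)) * Real.Gamma (n + 1) * Real.Gamma (n + (a + b - 1)) /
    (Real.Gamma (n + a) * Real.Gamma (n + b)) * r ^ n := by
    rw [Real.Gamma_nat_eq_factorial]; positivity
  rw [poissonCoeff, mul_right_comm, norm_mul, Real.norm_of_nonneg hk.le, Real.norm_eq_abs]
  refine (mul_le_mul_of_nonneg_left hPP hk.le).trans (le_of_eq ?_)
  rw [shiftedJacobi_eval_zero hb, shiftedJacobi_eval_one ha, Real.Gamma_nat_eq_factorial]
  have h4 : ((-1 : ℝ) ^ n) ^ 2 = 1 := by rw [← pow_mul, mul_comm, pow_mul]; norm_num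
  have := Nat.factorial_ne_zero n
  have e : b + a - 1 = a + b - 1 := by ring
  rw [div_pow, div_pow, mul_pow ((-1 : ℝ) ^ n), h4, e]
  field_simp

/-- The power series obtained by summing Watson's product formula. -/
lemma hasSum_poissonCoeff_of_small {a b x y r : ℝ} (ha : 0 < a) (hb : 0 < b) (hab : 1 < a + b)
    (hx : x ∈ Set.Icc (0 : ℝ) 1) (hy : y ∈ Set.Icc (0 : ℝ) 1) (hr0 : 0 < r) (hr1 : r < 1 / 10)
    (hg : ∀ v ∈ Set.Ioo (0 : ℝ) (1 / 4), Summable fun s : ℕ =>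
      (watsonPart a b y s).eval x * Real.Gamma (a + b + 2 * s) * v ^ s) :
    HasSum (fun n => poissonCoeff a b x y n * r ^ n)
      ((1 - r) * (1 + r) ^ (-(a + b)) * ∑' s : ℕ,
        (watsonPart a b y s).eval x * Real.Gamma (a + b + 2 * s) * (r / (1 + r) ^ 2) ^ s) := by
  have hl : 0 < a + b - 1 := by linarith
  set Q : ℕ → ℝ := fun s => (watsonPart a b y s).eval x with hQ
  have hQ0 : ∀ s, 0 ≤ Q s := watsonPart_nonneg ha hb hx hy
  set μ : ℕ → ℝ := fun s => a + b - 1 + 2 * s with hμ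
  have hμ0 : ∀ s, 0 < μ s := fun s => by simp only [hμ]; positivity
  have hinner : ∀ z : ℝ, |z| < 1 → ∀ s : ℕ, HasSum (fun i : ℕ => Q s * r ^ s *
      ((2 * i + μ s) * Real.Gamma (μ s + i) / i.factorial * z ^ i))
      ((1 + z) * (1 - z) ^ (-(a + b)) *
        (Q s * Real.Gamma (a + b + 2 * s) * (r / (1 - z) ^ 2) ^ s)) := by
    intro z hz s
    have h1z : 0 < 1 - z := by linarith [(abs_lt.1 hz).2]
    have h := (hasSum_linear_mul_Gamma_mul_pow (hμ0 s) hz).mul_left (Q s * r ^ s)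
    have e1 : μ s + 1 = a + b + 2 * s := by simp only [hμ]; ring
    have e2 : (1 - z) ^ (-μ s - 1) = (1 - z) ^ (-(a + b)) / ((1 - z) ^ 2) ^ s := by
      rw [← pow_mul, ← Real.rpow_natCast, ← Real.rpow_sub h1z]
      congr 1; simp only [hμ]; push_cast; ring
    rw [e1, e2] at h
    have e3 : (1 + z) * (1 - z) ^ (-(a + b)) *
        (Q s * Real.Gamma (a + b + 2 * s) * (r / (1 - z) ^ 2) ^ s) = Q s * r ^ s *
        (Real.Gamma (a + b + 2 * s) * ((1 + z) * ((1 - z) ^ (-(a + b)) / ((1 - z) ^ 2) ^ s))) := by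
      rw [div_pow]; ring
    rw [e3]
    exact h
  set F : ℕ × ℕ → ℝ := fun p => Q p.1 * r ^ p.1 *
      ((2 * p.2 + μ p.1) * Real.Gamma (μ p.1 + p.2) / p.2.factorial * (-r) ^ p.2) with hF
  have hFn : ∀ p, ‖F p‖ = Q p.1 * r ^ p.1 *
      ((2 * p.2 + μ p.1) * Real.Gamma (μ p.1 + p.2) / p.2.factorial * r ^ p.2) := by
    intro p
    have h1 := hμ0 p.1
    have h2 := hQ0 p.1
    have h3 := Real.Gamma_pos_of_pos (show 0 < μ p.1 + p.2 by positivity)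
    simp only [hF, norm_mul, norm_div, norm_pow, norm_neg, Real.norm_of_nonneg hr0.le,
      Real.norm_of_nonneg h2, Real.norm_of_nonneg h3.le,
      Real.norm_of_nonneg (show 0 ≤ 2 * (p.2 : ℝ) + μ p.1 by positivity),
      Real.norm_of_nonneg (show 0 ≤ (p.2.factorial : ℝ) by positivity)]
  have hsum : Summable F := by
    rw [← summable_norm_iff, summable_prod_of_nonneg (fun _ => norm_nonneg _)]
    have hr : |r| < 1 := by rw [abs_of_pos hr0]; linarith
    simp only [hFn]
    refine ⟨fun s => (hinner r hr s).summable, ?_⟩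
    simp only [fun s => (hinner r hr s).tsum_eq]
    -- Taking absolute values replaces `r / (1 + r)²` by `r / (1 - r)²`, which stays below `1/4`
    -- only for small `r`; `r < 1/10` suffices.
    refine (hg _ ⟨by have : 0 < 1 - r := by linarith
                     positivity, ?_⟩).mul_left _
    rw [div_lt_iff₀ (by have : 0 < 1 - r := by linarith
                        positivity)]
    nlinarith
  have hr' : |(-r)| < 1 := by rw [abs_neg, abs_of_pos hr0]; linarith
  have hS := hsum.hasSum
  have hfib := hS.prod_fiberwise (hinner (-r) hr')
  have hanti := hasSum_antidiagonal hS
  have := hfib.tsum_eq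
  rw [tsum_mul_left] at this
  simp only [sub_neg_eq_add, ← sub_eq_add_neg] at this
  rw [this]
  convert hanti using 2 with n
  rw [poissonCoeff_eq ha hb hab, sum_mul]
  refine sum_congr rfl fun p hp => ?_
  rw [← mem_antidiagonal.1 hp, pow_add]
  simp only [hF, neg_pow r]
  ring

/-- The sum of the spectral expansion of the Jacobi-Poisson kernel, as an Appell-type series
with positive terms. -/
theorem tsum_poissonCoeff_mul_pow {a b x y : ℝ} (ha : 0 < a) (hb : 0 < b) (hab : 1 < a + b)
    (hx : x ∈ Set.Icc (0 : ℝ) 1) (hy : y ∈ Set.Icc (0 : ℝ) 1)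
    (hg : ∀ v ∈ Set.Ioo (0 : ℝ) (1 / 4), Summable fun s : ℕ =>
      (watsonPart a b y s).eval x * Real.Gamma (a + b + 2 * s) * v ^ s)
    {r : ℝ} (hr : r ∈ Set.Ioo (0 : ℝ) 1) :
    ∑' n, poissonCoeff a b x y n * r ^ n = (1 - r) * (1 + r) ^ (-(a + b)) * ∑' s : ℕ,
        (watsonPart a b y s).eval x * Real.Gamma (a + b + 2 * s) * (r / (1 + r) ^ 2) ^ s := by
  have hL := analyticOnNhd_tsum_mul_pow (R := 1) fun r hr =>
    summable_poissonCoeff_mul_pow ha hb hab hx hy hr.1 hr.2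
  have hH := analyticOnNhd_tsum_mul_pow hg
  have hv : AnalyticOnNhd ℝ (fun r : ℝ => r / (1 + r) ^ 2) (Set.Ioo 0 1) := fun r hr => by
    have : (1 + r) ^ 2 ≠ 0 := by have := hr.1; positivity
    fun_prop (disch := assumption)
  have hmaps : Set.MapsTo (fun r : ℝ => r / (1 + r) ^ 2) (Set.Ioo 0 1) (Set.Ioo 0 (1 / 4)) := by
    intro r hr
    have h0 := hr.1
    refine ⟨by positivity, ?_⟩
    rw [div_lt_iff₀ (by positivity)]
    nlinarith [sq_pos_of_pos (sub_pos.2 hr.2)]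
  have hpre : AnalyticOnNhd ℝ (fun r : ℝ => (1 - r) * (1 + r) ^ (-(a + b))) (Set.Ioo 0 1) :=
    fun r hr => by
      have h0 := hr.1
      refine (by fun_prop : AnalyticAt ℝ (fun r : ℝ => 1 - r) r).mul ?_
      have h1 : 0 < 1 + r := by positivity
      have h2 : (fun r : ℝ => (1 + r) ^ (-(a + b))) =ᶠ[𝓝 r]
          fun r => Real.exp (Real.log (1 + r) * (-(a + b))) := by
        have : ∀ᶠ u in 𝓝 r, 0 < 1 + u :=
          (continuous_const.add continuous_id).continuousAt.eventually (lt_mem_nhds h1)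
        filter_upwards [this] with u hu using Real.rpow_def_of_pos hu _
      refine AnalyticAt.congr ?_ h2.symm
      have : AnalyticAt ℝ (fun r : ℝ => Real.log (1 + r)) r :=
        (by fun_prop : AnalyticAt ℝ (fun r : ℝ => 1 + r) r).log h1
      fun_prop
  have hR := hpre.mul (hH.comp hv hmaps)
  -- Rearrangement proves the identity only for small `r`. Both sides are analytic on `(0, 1)`, so
  -- agreement near `1/20` propagates.
  refine hL.eqOn_of_preconnected_of_eventuallyEq hR isPreconnected_Ioo
    (z₀ := 1 / 20) (by norm_num) ?_ hr
  have : Set.Ioo (0 : ℝ) (1 / 10) ∈ 𝓝 (1 / 20 : ℝ) := Ioo_mem_nhds (by norm_num) (by norm_num)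
  filter_upwards [this] with r hr
  exact (hasSum_poissonCoeff_of_small ha hb hab hx hy hr.1 hr.2 hg).tsum_eq

/-! ### Gamma function estimates uniform in the parameters -/

lemma sq_Gamma_midpoint_le {u v : ℝ} (hu : 0 < u) (hv : 0 < v) :
    Real.Gamma ((u + v) / 2) ^ 2 ≤ Real.Gamma u * Real.Gamma v := by
  have h := Real.Gamma_mul_add_mul_le_rpow_Gamma_mul_rpow_Gamma hu hv (a := 1 / 2) (b := 1 / 2)
    (by norm_num) (by norm_num) (by norm_num)
  have g1 := Real.Gamma_pos_of_pos hu
  have g2 := Real.Gamma_pos_of_pos hv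
  have g3 := Real.Gamma_pos_of_pos (show 0 < (u + v) / 2 by positivity)
  rw [← Real.mul_rpow g1.le g2.le, ← Real.sqrt_eq_rpow] at h
  have e : 1 / 2 * u + 1 / 2 * v = (u + v) / 2 := by ring
  rw [e] at h
  exact (Real.le_sqrt g3.le (by positivity)).1 h

/-- A reverse of log-convexity: midpoint convexity on the half-integer shifts of `x`, together with
`Γ(x + 1/2) = (x - 1/2) Γ(x - 1/2)`, leaves the ratio `x / (x - 1/2)`, at most `4` in this range. -/
lemma Gamma_mul_Gamma_quarter_le {x : ℝ} (hx : 3 / 4 ≤ x) :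
    Real.Gamma (x - 1 / 4) * Real.Gamma (x + 1 / 4) ≤ 2 * Real.Gamma x ^ 2 := by
  have h1 := sq_Gamma_midpoint_le (show 0 < x - 1 / 2 by linarith) (show 0 < x by linarith)
  have h2 := sq_Gamma_midpoint_le (show 0 < x by linarith) (show 0 < x + 1 / 2 by linarith)
  have h3 := sq_Gamma_midpoint_le (show 0 < x by linarith) (show 0 < x + 1 by linarith)
  have e1 : (x - 1 / 2 + x) / 2 = x - 1 / 4 := by ring
  have e2 : (x + (x + 1 / 2)) / 2 = x + 1 / 4 := by ring
  have e3 : (x + (x + 1)) / 2 = x + 1 / 2 := by ring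
  have e4 : Real.Gamma (x + 1 / 2) = (x - 1 / 2) * Real.Gamma (x - 1 / 2) := by
    rw [← Real.Gamma_add_one (by linarith)]; ring_nf
  rw [e1] at h1
  rw [e2, e4] at h2
  rw [e3, e4, Real.Gamma_add_one (by linarith)] at h3
  have g1 := Real.Gamma_pos_of_pos (show 0 < x by linarith)
  have g2 := Real.Gamma_pos_of_pos (show 0 < x - 1 / 2 by linarith)
  have g3 := Real.Gamma_pos_of_pos (show 0 < x - 1 / 4 by linarith)
  have g4 := Real.Gamma_pos_of_pos (show 0 < x + 1 / 4 by linarith)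
  set G := Real.Gamma x
  set S := Real.Gamma (x - 1 / 2)
  set U := Real.Gamma (x - 1 / 4)
  set V := Real.Gamma (x + 1 / 4)
  have hx2 : 0 < x - 1 / 2 := by linarith
  have h4 : (U * V) ^ 2 ≤ (S * G) * (G * ((x - 1 / 2) * S)) := by
    rw [mul_pow]
    exact mul_le_mul h1 h2 (by positivity) (by positivity)
  have h5 : (x - 1 / 2) * (U * V) ^ 2 ≤ (x - 1 / 2) * (2 * G ^ 2) ^ 2 := by
    calc (x - 1 / 2) * (U * V) ^ 2 ≤ (x - 1 / 2) * ((S * G) * (G * ((x - 1 / 2) * S))) := by gcongr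
      _ = ((x - 1 / 2) * S) ^ 2 * G ^ 2 := by ring
      _ ≤ (G * (x * G)) * G ^ 2 := by gcongr
      _ = x * G ^ 4 := by ring
      _ ≤ (4 * (x - 1 / 2)) * G ^ 4 := by gcongr; linarith
      _ = _ := by ring
  exact (pow_le_pow_iff_left₀ (by positivity) (by positivity) two_ne_zero).1
    (le_of_mul_le_mul_left h5 hx2)

/-- Duplication turns the left side into the product of Gamma values at `m + 1 + α/2 ± 1/4`. The
condition `α ≥ -1/2` is exactly what the previous estimate needs at `m = 0`, and log-convexity
finishes. The constant does not depend on `α`. -/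
lemma sqrt_pi_mul_Gamma_le {α : ℝ} (hα : -1 / 2 ≤ α) (m : ℕ) :
    √Real.pi * (Real.Gamma (2 * m + (α + 1 / 2) + 1) * 2 ^ (-(2 * m + (α + 1 / 2)))) ≤
      2 * (m.factorial * Real.Gamma (α + 1 + m)) := by
  have hm : (0 : ℝ) ≤ m := m.cast_nonneg
  have h1 := Real.Gamma_mul_Gamma_add_half (m + α / 2 + 3 / 4)
  have h2 := Gamma_mul_Gamma_quarter_le (show 3 / 4 ≤ m + 1 + α / 2 by linarith)
  have h3 := sq_Gamma_midpoint_le (show (0 : ℝ) < m + 1 by linarith)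
    (show 0 < α + 1 + m by linarith)
  have e1 : (m : ℝ) + α / 2 + 3 / 4 = m + 1 + α / 2 - 1 / 4 := by ring
  have e2 : (m : ℝ) + 1 + α / 2 - 1 / 4 + 1 / 2 = m + 1 + α / 2 + 1 / 4 := by ring
  have e3 : 2 * ((m : ℝ) + 1 + α / 2 - 1 / 4) = 2 * m + (α + 1 / 2) + 1 := by ring
  have e4 : (m + 1 + (α + 1 + m)) / 2 = m + 1 + α / 2 := by ring
  have e5 : 1 - (2 * (m : ℝ) + (α + 1 / 2) + 1) = -(2 * m + (α + 1 / 2)) := by ring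
  rw [e1, e2, e3, e5] at h1
  rw [e4, Real.Gamma_nat_eq_factorial] at h3
  rw [h1] at h2
  linarith

/-- Interpolates a fractional exponential term by its two integer neighbours: log-convexity compares
`(n + 1)!` with `Γ(q + 1) (q + 1) ^ (1 - τ)`, and weighted AM-GM absorbs the fractional powers. -/
lemma rpow_div_Gamma_le {q z τ : ℝ} {n : ℕ} (hz : 0 < z) (hτ0 : 0 ≤ τ) (hτ1 : τ < 1)
    (hq : q = n + τ) :
    z ^ q / Real.Gamma (q + 1) ≤ z ^ n / n.factorial + z ^ (n + 1) / (n + 1).factorial := by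
  rcases hτ0.eq_or_lt with rfl | hτ
  · rw [hq, add_zero, Real.Gamma_nat_eq_factorial, Real.rpow_natCast]
    have : 0 ≤ z ^ (n + 1) / (n + 1).factorial := by positivity
    linarith
  have hn : (0 : ℝ) ≤ n := n.cast_nonneg
  have hq0 : 0 < q + 1 := by rw [hq]; positivity
  have h1 := Real.Gamma_mul_add_mul_le_rpow_Gamma_mul_rpow_Gamma hq0
    (show 0 < q + 1 + 1 by positivity) hτ (sub_pos.2 hτ1) (by ring)
  have hG := Real.Gamma_pos_of_pos hq0
  have e1 : τ * (q + 1) + (1 - τ) * (q + 1 + 1) = ((n + 1 : ℕ) : ℝ) + 1 := by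
    rw [hq]; push_cast; ring
  rw [e1, Real.Gamma_nat_eq_factorial, Real.Gamma_add_one hq0.ne', Real.mul_rpow hq0.le hG.le,
    mul_left_comm, ← Real.rpow_add hG, add_sub_cancel, Real.rpow_one] at h1
  have h2 := Real.geom_mean_le_arith_mean2_weighted hτ0 (sub_pos.2 hτ1).le hz.le hq0.le (by ring)
  have h3 : τ * z + (1 - τ) * (q + 1) ≤ z + (n + 1) := by
    rw [hq]
    nlinarith [mul_nonneg hτ0 hn, mul_pos hτ hτ, mul_le_mul_of_nonneg_right hτ1.le hz.le]
  have h4 : z ^ q * (n + 1).factorial ≤ z ^ n * (z + (n + 1)) * Real.Gamma (q + 1) := by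
    calc z ^ q * (n + 1).factorial ≤ z ^ q * ((q + 1) ^ (1 - τ) * Real.Gamma (q + 1)) := by gcongr
      _ = z ^ n * (z ^ τ * (q + 1) ^ (1 - τ)) * Real.Gamma (q + 1) := by
        rw [hq, Real.rpow_add hz, Real.rpow_natCast]; ring
      _ ≤ _ := by gcongr; linarith
  have hf : ((n + 1).factorial : ℝ) ≠ 0 := by exact_mod_cast Nat.factorial_ne_zero _
  calc z ^ q / Real.Gamma (q + 1) ≤ z ^ n * (z + (n + 1)) / (n + 1).factorial := by
        rw [div_le_div_iff₀ hG (by positivity)]; exact h4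
    _ = _ := by
        rw [Nat.factorial_succ]
        have := Nat.factorial_ne_zero n
        push_cast
        field_simp
        ring

/-- The exponents advance by two, so the neighbouring pairs are disjoint and each term of the
exponential series is used at most once. Hence the bound is free of `p`. -/
lemma sum_rpow_div_Gamma_le_exp {p z : ℝ} (hp : 0 ≤ p) (hz : 0 < z) (M : ℕ) :
    ∑ m ∈ range M, z ^ (2 * m + p) / Real.Gamma (2 * m + p + 1) ≤ Real.exp z := by
  have h : ∑ m ∈ range M, z ^ (2 * m + p) / Real.Gamma (2 * m + p + 1) ≤
      ∑ j ∈ range (⌊p⌋₊ + 2 * M), z ^ j / j.factorial := by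
    induction M with
    | zero => simpa using sum_nonneg fun j _ => by positivity
    | succ M ih =>
      have e : ⌊p⌋₊ + 2 * (M + 1) = ⌊p⌋₊ + 2 * M + 1 + 1 := by ring
      have h1 := rpow_div_Gamma_le (q := 2 * M + p) (n := ⌊p⌋₊ + 2 * M) hz
        (sub_nonneg.2 (Nat.floor_le hp)) (by linarith [Nat.lt_floor_add_one p])
        (by push_cast; ring)
      rw [sum_range_succ, e, sum_range_succ, sum_range_succ]
      linarith
  exact h.trans (Real.sum_le_exp_of_nonneg hz.le _)

/-- Writing the outer Gamma factor as an Euler integral decouples the two sums. Each is at most an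
exponential, leaving `∫ exp (-(1 - A - B) u) du` over `u > 0`. -/
lemma sum_binomial_rpow_le {p q A B : ℝ} (hp : 0 ≤ p) (hq : 0 ≤ q) (hA : 0 < A) (hB : 0 < B)
    (hAB : A + B < 1) (M : ℕ) :
    ∑ m ∈ range M, ∑ k ∈ range M, Real.Gamma (2 * m + p + (2 * k + q) + 1) *
      (A ^ (2 * m + p) / Real.Gamma (2 * m + p + 1)) *
      (B ^ (2 * k + q) / Real.Gamma (2 * k + q + 1)) ≤ 1 / (1 - (A + B)) := by
  set c : ℕ → ℕ → ℝ := fun m k => (A ^ (2 * m + p) / Real.Gamma (2 * m + p + 1)) *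
      (B ^ (2 * k + q) / Real.Gamma (2 * k + q + 1)) with hc
  have hs : ∀ m k : ℕ, 0 < 2 * m + p + (2 * k + q) + 1 := fun m k => by positivity
  have hint : ∀ m k : ℕ, IntegrableOn
      (fun u : ℝ => c m k * (Real.exp (-u) * u ^ (2 * m + p + (2 * k + q) + 1 - 1))) (Set.Ioi 0) :=
    fun m k => (Real.GammaIntegral_convergent (hs m k)).const_mul _
  have e : ∑ m ∈ range M, ∑ k ∈ range M, Real.Gamma (2 * m + p + (2 * k + q) + 1) *
      (A ^ (2 * m + p) / Real.Gamma (2 * m + p + 1)) *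
      (B ^ (2 * k + q) / Real.Gamma (2 * k + q + 1)) =
      ∫ u in Set.Ioi (0 : ℝ), ∑ m ∈ range M, ∑ k ∈ range M,
        c m k * (Real.exp (-u) * u ^ (2 * m + p + (2 * k + q) + 1 - 1)) := by
    rw [integral_finsetSum _ fun m _ => integrable_finsetSum _ fun k _ => hint m k]
    refine sum_congr rfl fun m _ => ?_
    rw [integral_finsetSum _ fun k _ => hint m k]
    refine sum_congr rfl fun k _ => ?_
    rw [integral_const_mul, ← Real.Gamma_eq_integral (hs m k)]
    simp only [hc]; ring
  have hneg : A + B - 1 < 0 := by linarith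
  have e2 : (1 : ℝ) / (1 - (A + B)) = ∫ u in Set.Ioi (0 : ℝ), Real.exp ((A + B - 1) * u) := by
    rw [integral_exp_mul_Ioi hneg, mul_zero, Real.exp_zero, ← neg_sub 1 (A + B), div_neg, neg_div,
      neg_neg]
  rw [e, e2]
  refine setIntegral_mono_on
    (integrable_finsetSum _ fun m _ => integrable_finsetSum _ fun k _ => hint m k)
    (integrableOn_exp_mul_Ioi hneg 0) measurableSet_Ioi fun u hu => ?_
  have hu0 : 0 < u := hu
  have h1 := sum_rpow_div_Gamma_le_exp hp (mul_pos hA hu0) M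
  have h2 := sum_rpow_div_Gamma_le_exp hq (mul_pos hB hu0) M
  have e3 : ∑ m ∈ range M, ∑ k ∈ range M,
        c m k * (Real.exp (-u) * u ^ (2 * m + p + (2 * k + q) + 1 - 1)) = Real.exp (-u) *
      ((∑ m ∈ range M, (A * u) ^ (2 * m + p) / Real.Gamma (2 * m + p + 1)) *
      (∑ k ∈ range M, (B * u) ^ (2 * k + q) / Real.Gamma (2 * k + q + 1))) := by
    rw [sum_mul_sum, mul_sum]
    refine sum_congr rfl fun m _ => ?_
    rw [mul_sum]
    refine sum_congr rfl fun k _ => ?_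
    rw [add_sub_cancel_right, Real.rpow_add hu0, Real.mul_rpow hA.le hu0.le,
      Real.mul_rpow hB.le hu0.le]
    simp only [hc]; ring
  have e4 : Real.exp ((A + B - 1) * u) = Real.exp (-u) * (Real.exp (A * u) * Real.exp (B * u)) := by
    rw [← Real.exp_add, ← Real.exp_add]; ring_nf
  rw [e3, e4]
  refine mul_le_mul_of_nonneg_left (mul_le_mul h1 h2 ?_ (Real.exp_pos _).le) (Real.exp_pos _).le
  refine sum_nonneg fun k _ => ?_
  have := Real.Gamma_pos_of_pos (show 0 < 2 * (k : ℝ) + q + 1 by positivity)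
  positivity

/-! ### Uniform bound for the Appell-type series -/

lemma sum_range_antidiagonal_le {f : ℕ → ℕ → ℝ} (hf : ∀ m k, 0 ≤ f m k) (M : ℕ) :
    ∑ s ∈ range M, ∑ p ∈ antidiagonal s, f p.1 p.2 ≤
      ∑ m ∈ range M, ∑ k ∈ range M, f m k := by
  rw [← sum_product', ← sum_biUnion]
  · refine sum_le_sum_of_subset_of_nonneg ?_ fun p _ _ => hf _ _
    intro p hp
    simp only [mem_biUnion, mem_range, HasAntidiagonal.mem_antidiagonal, mem_product] at hp ⊢
    obtain ⟨s, h1, h2⟩ := hp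
    omega
  · intro i _ j _ hij
    rw [Function.onFun, Finset.disjoint_left]
    intro p h1 h2
    exact hij ((mem_antidiagonal.1 h1).symm.trans (mem_antidiagonal.1 h2))

/-- The weight `A ^ (α + 1/2)` merges with `A ^ (2 m)` into one power, so each single-variable
factor becomes a term of the fractional exponential series. -/
lemma rpow_mul_sq_pow_div_le {α A z w : ℝ} (hα : -1 / 2 ≤ α) (hA : 0 < A) (hz : 0 < z)
    (hw : w = A ^ 2) (m : ℕ) :
    A ^ (α + 1 / 2) * w ^ m / (Real.Gamma (α + 1 + m) * m.factorial) *
      (z / 2) ^ (2 * m + (α + 1 / 2)) ≤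
    2 / √Real.pi * ((z * A) ^ (2 * m + (α + 1 / 2)) / Real.Gamma (2 * m + (α + 1 / 2) + 1)) := by
  have h := sqrt_pi_mul_Gamma_le hα m
  have hm : (0 : ℝ) ≤ m := m.cast_nonneg
  have g1 := Real.Gamma_pos_of_pos (show 0 < 2 * m + (α + 1 / 2) + 1 by linarith)
  have g2 := Real.Gamma_pos_of_pos (show 0 < α + 1 + m by linarith)
  have hpi := Real.sqrt_pos.2 Real.pi_pos
  have e1 : A ^ (α + 1 / 2) * w ^ m = A ^ (2 * m + (α + 1 / 2)) := by
    rw [Real.rpow_add hA (2 * (m : ℝ)), hw, ← pow_mul, ← Real.rpow_natCast]; push_cast; ring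
  have e2 : (z / 2) ^ (2 * m + (α + 1 / 2)) =
      z ^ (2 * m + (α + 1 / 2)) * 2 ^ (-(2 * m + (α + 1 / 2))) := by
    rw [Real.div_rpow hz.le two_pos.le, Real.rpow_neg two_pos.le, div_eq_mul_inv]
  rw [e1, e2, Real.mul_rpow hz.le hA.le]
  generalize 2 * m + (α + 1 / 2) = p at *
  have hAp : 0 < A ^ p := Real.rpow_pos_of_pos hA _
  have hzp : 0 < z ^ p := Real.rpow_pos_of_pos hz _
  rw [div_mul_eq_mul_div, div_mul_div_comm, div_le_div_iff₀ (by positivity) (by positivity)]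
  calc _ = A ^ p * z ^ p * (√Real.pi * (Real.Gamma (p + 1) * 2 ^ (-p))) := by ring
    _ ≤ A ^ p * z ^ p * (2 * (m.factorial * Real.Gamma (α + 1 + m))) := by gcongr
    _ = _ := by ring

/-- Uniform bound for the partial sums of the Appell-type series. -/
theorem sum_watsonPart_le {α β x y A B z : ℝ} (hα : -1 / 2 ≤ α) (hβ : -1 / 2 ≤ β)
    (hA : 0 < A) (hB : 0 < B) (hxy : x * y = A ^ 2) (hxy' : (1 - x) * (1 - y) = B ^ 2)
    (hz : 0 < z) (hzAB : z * (A + B) < 1) (M : ℕ) :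
    ∑ s ∈ range M, A ^ (α + 1 / 2) * B ^ (β + 1 / 2) *
      ((watsonPart (α + 1) (β + 1) y s).eval x * Real.Gamma (α + 1 + (β + 1) + 2 * s) *
        (z / 2) ^ (α + β + 1 + 2 * s)) ≤ 2 / (1 - z * (A + B)) := by
  set p := α + 1 / 2 with hp
  set q := β + 1 / 2 with hq
  have hp0 : 0 ≤ p := by rw [hp]; linarith
  have hq0 : 0 ≤ q := by rw [hq]; linarith
  set u : ℕ → ℝ := fun m => A ^ p * (x * y) ^ m / (Real.Gamma (α + 1 + m) * m.factorial) *
      (z / 2) ^ (2 * m + p) with hu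
  set v : ℕ → ℝ := fun k => B ^ q * ((1 - x) * (1 - y)) ^ k /
      (Real.Gamma (β + 1 + k) * k.factorial) * (z / 2) ^ (2 * k + q) with hv
  have hu0 : ∀ m, 0 ≤ u m := fun m => by
    have := Real.Gamma_pos_of_pos (show 0 < α + 1 + m by have := m.cast_nonneg (α := ℝ); linarith)
    simp only [hu, hxy]; positivity
  have hv0 : ∀ m, 0 ≤ v m := fun m => by
    have := Real.Gamma_pos_of_pos (show 0 < β + 1 + m by have := m.cast_nonneg (α := ℝ); linarith)
    simp only [hv, hxy']; positivity
  have hG : ∀ m k : ℕ, 0 < Real.Gamma (2 * m + p + (2 * k + q) + 1) := fun m k =>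
    Real.Gamma_pos_of_pos (by positivity)
  have e : ∀ s, A ^ p * B ^ q * ((watsonPart (α + 1) (β + 1) y s).eval x *
      Real.Gamma (α + 1 + (β + 1) + 2 * s) * (z / 2) ^ (α + β + 1 + 2 * s)) =
      ∑ r ∈ antidiagonal s, Real.Gamma (2 * r.1 + p + (2 * r.2 + q) + 1) * u r.1 * v r.2 := by
    intro s
    rw [watsonPart, eval_finsetSum, sum_mul, sum_mul, mul_sum]
    refine sum_congr rfl fun r hr => ?_
    have hs : (s : ℝ) = r.1 + r.2 := by rw [← mem_antidiagonal.1 hr]; push_cast; rfl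
    have e1 : α + 1 + (β + 1) + 2 * s = 2 * r.1 + p + (2 * r.2 + q) + 1 := by
      rw [hs, hp, hq]; ring
    have e2 : α + β + 1 + 2 * s = 2 * r.1 + p + (2 * r.2 + q) := by rw [hs, hp, hq]; ring
    rw [e1, e2, Real.rpow_add (show 0 < z / 2 by positivity)]
    simp only [eval_mul, eval_C, eval_pow, eval_X, eval_sub, eval_one, hu, hv, mul_pow]
    field_simp
  rw [sum_congr rfl fun s _ => e s]
  refine (sum_range_antidiagonal_le (f := fun m k =>
    Real.Gamma (2 * m + p + (2 * k + q) + 1) * u m * v k) (fun m k =>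
    mul_nonneg (mul_nonneg (hG m k).le (hu0 m)) (hv0 k)) M).trans ?_
  have hpi := Real.sqrt_pos.2 Real.pi_pos
  have hfin := sum_binomial_rpow_le hp0 hq0 (mul_pos hz hA) (mul_pos hz hB)
    (by rw [← mul_add]; exact hzAB) M
  rw [← mul_add] at hfin
  -- Each of the two variables costs `2 / √π`; together `4 / π ≤ 2`.
  have hc : 2 / √Real.pi * (2 / √Real.pi) ≤ 2 := by
    rw [div_mul_div_comm, Real.mul_self_sqrt Real.pi_pos.le, div_le_iff₀ Real.pi_pos]
    linarith [Real.pi_gt_three]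
  have h1 : 0 < 1 - z * (A + B) := by linarith
  calc _ ≤ ∑ m ∈ range M, ∑ k ∈ range M, 2 / √Real.pi * (2 / √Real.pi) *
        (Real.Gamma (2 * m + p + (2 * k + q) + 1) *
        ((z * A) ^ (2 * m + p) / Real.Gamma (2 * m + p + 1)) *
        ((z * B) ^ (2 * k + q) / Real.Gamma (2 * k + q + 1))) := by
        refine sum_le_sum fun m _ => sum_le_sum fun k _ => ?_
        have b1 := rpow_mul_sq_pow_div_le hα hA hz hxy m
        have b2 := rpow_mul_sq_pow_div_le hβ hB hz hxy' k
        calc _ = Real.Gamma (2 * m + p + (2 * k + q) + 1) * (u m * v k) := by ring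
          _ ≤ Real.Gamma (2 * m + p + (2 * k + q) + 1) * (_ * _) :=
            mul_le_mul_of_nonneg_left (mul_le_mul b1 b2 (hv0 k) ((hu0 m).trans b1)) (hG m k).le
          _ = _ := by ring
    _ = 2 / √Real.pi * (2 / √Real.pi) * ∑ m ∈ range M, ∑ k ∈ range M,
        (Real.Gamma (2 * m + p + (2 * k + q) + 1) *
        ((z * A) ^ (2 * m + p) / Real.Gamma (2 * m + p + 1)) *
        ((z * B) ^ (2 * k + q) / Real.Gamma (2 * k + q + 1))) := by simp only [mul_sum]
    _ ≤ 2 / √Real.pi * (2 / √Real.pi) * (1 / (1 - z * (A + B))) :=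
        mul_le_mul_of_nonneg_left hfin (by positivity)
    _ ≤ 2 * (1 / (1 - z * (A + B))) := mul_le_mul_of_nonneg_right hc (by positivity)
    _ = _ := by ring

/-! ### Integration in time -/

lemma exists_integral_div_rpow_le {σ : ℝ} (hσ0 : 0 < σ) (hσ1 : σ < 1) :
    ∃ C : ℝ, 0 < C ∧ ∀ (f : ℝ → ℝ) (δ b : ℝ), 0 < δ → 0 < b → ContinuousOn f (Set.Ioi 0) →
      (∀ t, 0 < t → 0 ≤ f t) → (∀ t, 0 < t → t ≤ 2 → f t ≤ 2 * t / δ ^ 2) →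
      (∀ t, 0 < t → t ≤ 2 → f t ≤ 16 / t) → (∀ t, 2 < t → f t ≤ 8 * Real.exp (-(b * (t - 2) / 2))) →
      IntegrableOn (fun t => f t / t ^ (1 - σ)) (Set.Ioi 0) ∧
        ∫ t in Set.Ioi (0 : ℝ), f t / t ^ (1 - σ) ≤ C * (1 / b + 1 / δ ^ (1 - σ)) := by
  have h1σ : 0 < 1 - σ := by linarith
  refine ⟨16 + 2 / (σ + 1) + 16 / (1 - σ), by positivity, ?_⟩
  intro f δ b hδ hb hf hf0 hf1 hf2 hf3
  -- Three nonnegative majorants for `t ≤ δ`, `t > δ` and `t > 2`. Their supports may overlap, which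
  -- avoids comparing `δ` with `2`; the third alone involves `b`.
  set m₁ : ℝ → ℝ := (Set.Ioc 0 δ).indicator fun t => 2 / δ ^ 2 * t ^ σ with hm₁
  set m₂ : ℝ → ℝ := (Set.Ioi δ).indicator fun t => 16 * t ^ (σ - 2) with hm₂
  set m₃ : ℝ → ℝ := (Set.Ioi 2).indicator fun t => 8 * Real.exp b * Real.exp (-(b / 2) * t) with hm₃
  have hi₁ : Integrable m₁ := by
    rw [hm₁, integrable_indicator_iff measurableSet_Ioc]
    refine Integrable.const_mul ?_ _
    exact (intervalIntegrable_iff_integrableOn_Ioc_of_le hδ.le).1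
      (intervalIntegral.intervalIntegrable_rpow' (by linarith))
  have hi₂ : Integrable m₂ := by
    rw [hm₂, integrable_indicator_iff measurableSet_Ioi]
    exact Integrable.const_mul (integrableOn_Ioi_rpow_of_lt (by linarith) hδ) _
  have hi₃ : Integrable m₃ := by
    rw [hm₃, integrable_indicator_iff measurableSet_Ioi]
    exact Integrable.const_mul (integrableOn_exp_mul_Ioi (by linarith) 2) _
  have hp₁ : ∀ t, 0 ≤ m₁ t := Set.indicator_nonneg fun t ht => by
    have := Real.rpow_nonneg ht.1.le σ; positivity
  have hp₂ : ∀ t, 0 ≤ m₂ t := Set.indicator_nonneg fun t ht => by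
    have := Real.rpow_nonneg (hδ.trans ht).le (σ - 2); positivity
  have hp₃ : ∀ t, 0 ≤ m₃ t := Set.indicator_nonneg fun t ht => by positivity
  have hI₁ : ∫ t, m₁ t = 2 / (σ + 1) * (1 / δ ^ (1 - σ)) := by
    rw [hm₁, integral_indicator measurableSet_Ioc, integral_const_mul,
      ← intervalIntegral.integral_of_le hδ.le, integral_rpow (Or.inl (by linarith)),
      Real.zero_rpow (by positivity), sub_zero]
    have : δ ^ (σ + 1) = δ ^ 2 / δ ^ (1 - σ) := by
      rw [← Real.rpow_natCast, ← Real.rpow_sub hδ]; congr 1; push_cast; ring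
    rw [this]
    field_simp
  have hI₂ : ∫ t, m₂ t = 16 / (1 - σ) * (1 / δ ^ (1 - σ)) := by
    rw [hm₂, integral_indicator measurableSet_Ioi, integral_const_mul,
      integral_Ioi_rpow_of_lt (by linarith) hδ]
    have e : σ - 2 + 1 = -(1 - σ) := by ring
    rw [e, Real.rpow_neg hδ.le]
    field_simp
  have hI₃ : ∫ t, m₃ t = 16 * (1 / b) := by
    rw [hm₃, integral_indicator measurableSet_Ioi, integral_const_mul,
      integral_exp_mul_Ioi (by linarith)]
    have : Real.exp b * Real.exp (-(b / 2) * 2) = 1 := by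
      rw [← Real.exp_add]; simp
    have e : 8 * Real.exp b * (-Real.exp (-(b / 2) * 2) / -(b / 2)) =
      16 / b * (Real.exp b * Real.exp (-(b / 2) * 2)) := by field_simp; ring
    rw [e, this]; ring
  have hle : ∀ t ∈ Set.Ioi (0 : ℝ), f t / t ^ (1 - σ) ≤ (m₁ + m₂ + m₃) t := by
    intro t ht
    have ht0 : 0 < t := ht
    have htp := Real.rpow_pos_of_pos ht0 (1 - σ)
    simp only [Pi.add_apply]
    have n₁ := hp₁ t
    have n₂ := hp₂ t
    have n₃ := hp₃ t
    rcases le_or_gt t 2 with h | h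
    · rcases le_or_gt t δ with h' | h'
      · have e : m₁ t = 2 * t / δ ^ 2 / t ^ (1 - σ) := by
          rw [hm₁, Set.indicator_of_mem (show t ∈ Set.Ioc 0 δ from ⟨ht0, h'⟩)]
          have : t ^ σ = t / t ^ (1 - σ) := by
            rw [← Real.rpow_one_sub' ht0.le (by linarith)]; ring_nf
          rw [this]; ring
        have := div_le_div_of_nonneg_right (hf1 t ht0 h) htp.le
        linarith
      · have e : m₂ t = 16 / t / t ^ (1 - σ) := by
          rw [hm₂, Set.indicator_of_mem (show t ∈ Set.Ioi δ from h')]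
          have : t ^ (σ - 2) = 1 / (t * t ^ (1 - σ)) := by
            rw [← Real.rpow_one_add' ht0.le (by linarith), one_div, ← Real.rpow_neg ht0.le]
            ring_nf
          rw [this]; field_simp
        have := div_le_div_of_nonneg_right (hf2 t ht0 h) htp.le
        linarith
    · have e : m₃ t = 8 * Real.exp (-(b * (t - 2) / 2)) := by
        rw [hm₃, Set.indicator_of_mem (show t ∈ Set.Ioi 2 from h), mul_assoc, ← Real.exp_add]
        ring_nf
      have h1 : 1 ≤ t ^ (1 - σ) := Real.one_le_rpow (by linarith) h1σ.le
      have := (div_le_self (hf0 t ht0) h1).trans (hf3 t h)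
      linarith
  have hmaj : Integrable (m₁ + m₂ + m₃) := (hi₁.add hi₂).add hi₃
  have hcont : ContinuousOn (fun t => f t / t ^ (1 - σ)) (Set.Ioi 0) :=
    hf.div (fun t ht => (Real.continuousAt_rpow_const t _ (Or.inl (ne_of_gt ht))).continuousWithinAt)
      fun t ht => (Real.rpow_pos_of_pos ht _).ne'
  have hint : IntegrableOn (fun t => f t / t ^ (1 - σ)) (Set.Ioi 0) := by
    refine Integrable.mono' hmaj.integrableOn (hcont.aestronglyMeasurable measurableSet_Ioi) ?_
    refine (ae_restrict_mem measurableSet_Ioi).mono fun t ht => ?_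
    rw [Real.norm_of_nonneg (div_nonneg (hf0 t ht) (Real.rpow_nonneg (le_of_lt ht) _))]
    exact hle t ht
  refine ⟨hint, ?_⟩
  calc ∫ t in Set.Ioi (0 : ℝ), f t / t ^ (1 - σ) ≤ ∫ t in Set.Ioi (0 : ℝ), (m₁ + m₂ + m₃) t :=
        setIntegral_mono_on hint hmaj.integrableOn measurableSet_Ioi hle
    _ ≤ ∫ t, (m₁ + m₂ + m₃) t := setIntegral_le_integral hmaj
        (.of_forall fun t => add_nonneg (add_nonneg (hp₁ t) (hp₂ t)) (hp₃ t))
    _ = 2 / (σ + 1) * (1 / δ ^ (1 - σ)) + 16 / (1 - σ) * (1 / δ ^ (1 - σ)) + 16 * (1 / b) := by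
        have e1 : ∫ t, (m₁ + m₂ + m₃) t = (∫ t, (m₁ + m₂) t) + ∫ t, m₃ t :=
          integral_add (hi₁.add hi₂) hi₃
        have e2 : ∫ t, (m₁ + m₂) t = (∫ t, m₁ t) + ∫ t, m₂ t := integral_add hi₁ hi₂
        rw [e1, e2, hI₁, hI₂, hI₃]
    _ ≤ _ := by
        have i1 : 0 < 1 / δ ^ (1 - σ) := by positivity
        have i2 : 0 < 1 / b := by positivity
        have i3 : 0 < 2 / (σ + 1) := by positivity
        have i4 : 0 < 16 / (1 - σ) := by positivity
        nlinarith [mul_pos i3 i2, mul_pos i4 i2]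

/-! ### The weighted Poisson kernel and its bounds for small and large times -/

/-- The terms of the Appell-type series for the Jacobi-Poisson kernel, multiplied by the
conjugating weights `A ^ (α + 1 / 2)` and `B ^ (β + 1 / 2)`. -/
noncomputable def appellTerm (α β x y A B z : ℝ) (s : ℕ) : ℝ :=
  A ^ (α + 1 / 2) * B ^ (β + 1 / 2) *
    ((watsonPart (α + 1) (β + 1) y s).eval x * Real.Gamma (α + 1 + (β + 1) + 2 * s) *
      (z / 2) ^ (α + β + 1 + 2 * s))

section Appell

variable {α β x y A B z : ℝ}

lemma appellTerm_nonneg (hα : -1 / 2 ≤ α) (hβ : -1 / 2 ≤ β) (hA : 0 < A) (hB : 0 < B)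
    (hx : x ∈ Set.Icc (0 : ℝ) 1) (hy : y ∈ Set.Icc (0 : ℝ) 1) (hz : 0 < z) (s : ℕ) :
    0 ≤ appellTerm α β x y A B z s := by
  have h1 := watsonPart_nonneg (a := α + 1) (b := β + 1) (by linarith) (by linarith) hx hy s
  have h2 := Real.Gamma_pos_of_pos (show 0 < α + 1 + (β + 1) + 2 * s by
    have := s.cast_nonneg (α := ℝ); linarith)
  have h3 := Real.rpow_pos_of_pos hA (α + 1 / 2)
  have h4 := Real.rpow_pos_of_pos hB (β + 1 / 2)
  have h5 := Real.rpow_pos_of_pos (half_pos hz) (α + β + 1 + 2 * s)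
  unfold appellTerm
  positivity

lemma summable_appellTerm (hα : -1 / 2 ≤ α) (hβ : -1 / 2 ≤ β) (hA : 0 < A) (hB : 0 < B)
    (hx : x ∈ Set.Icc (0 : ℝ) 1) (hy : y ∈ Set.Icc (0 : ℝ) 1)
    (hxy : x * y = A ^ 2) (hxy' : (1 - x) * (1 - y) = B ^ 2)
    (hz : 0 < z) (hzAB : z * (A + B) < 1) : Summable (appellTerm α β x y A B z) :=
  summable_of_sum_range_le (appellTerm_nonneg hα hβ hA hB hx hy hz)
    (sum_watsonPart_le hα hβ hA hB hxy hxy' hz hzAB)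

lemma tsum_appellTerm_le (hα : -1 / 2 ≤ α) (hβ : -1 / 2 ≤ β) (hA : 0 < A) (hB : 0 < B)
    (hx : x ∈ Set.Icc (0 : ℝ) 1) (hy : y ∈ Set.Icc (0 : ℝ) 1)
    (hxy : x * y = A ^ 2) (hxy' : (1 - x) * (1 - y) = B ^ 2)
    (hz : 0 < z) (hzAB : z * (A + B) < 1) :
    ∑' s, appellTerm α β x y A B z s ≤ 2 / (1 - z * (A + B)) :=
  Real.tsum_le_of_sum_range_le (appellTerm_nonneg hα hβ hA hB hx hy hz)
    (sum_watsonPart_le hα hβ hA hB hxy hxy' hz hzAB)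

lemma summable_watsonPart_mul_pow (hα : -1 / 2 ≤ α) (hβ : -1 / 2 ≤ β) (hA : 0 < A) (hB : 0 < B)
    (hx : x ∈ Set.Icc (0 : ℝ) 1) (hy : y ∈ Set.Icc (0 : ℝ) 1)
    (hxy : x * y = A ^ 2) (hxy' : (1 - x) * (1 - y) = B ^ 2) (hAB : A + B ≤ 1)
    {v : ℝ} (hv : v ∈ Set.Ioo (0 : ℝ) (1 / 4)) :
    Summable fun s : ℕ => (watsonPart (α + 1) (β + 1) y s).eval x *
      Real.Gamma (α + 1 + (β + 1) + 2 * s) * v ^ s := by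
  have hv0 := hv.1
  have hs0 := Real.sqrt_pos.2 hv0
  have hs1 : √v < 1 / 2 := by
    rw [Real.sqrt_lt' (by norm_num)]; linarith [hv.2]
  have h := summable_appellTerm (z := 2 * √v) hα hβ hA hB hx hy hxy hxy' (by positivity)
    (by nlinarith [add_pos hA hB])
  have h3 := Real.rpow_pos_of_pos hA (α + 1 / 2)
  have h4 := Real.rpow_pos_of_pos hB (β + 1 / 2)
  have h5 := Real.rpow_pos_of_pos hs0 (α + β + 1)
  have hc : A ^ (α + 1 / 2) * B ^ (β + 1 / 2) * √v ^ (α + β + 1) ≠ 0 := by positivity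
  refine (summable_mul_left_iff hc).1 (h.congr fun s => ?_)
  have e : (√v) ^ (2 * (s : ℝ)) = v ^ s := by
    rw [Real.rpow_mul hs0.le, Real.rpow_two, Real.sq_sqrt hv0.le, Real.rpow_natCast]
  rw [appellTerm, mul_div_cancel_left₀ _ two_ne_zero, Real.rpow_add hs0, e]
  ring

/-- Every exponent of `z` is at least `α + β + 1`, so shrinking `z` by `w ≤ 1` gains that power.
This is the source of exponential decay in time. -/
lemma tsum_appellTerm_le_rpow_mul (hα : -1 / 2 ≤ α) (hβ : -1 / 2 ≤ β)
    (hA : 0 < A) (hB : 0 < B)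
    (hx : x ∈ Set.Icc (0 : ℝ) 1) (hy : y ∈ Set.Icc (0 : ℝ) 1)
    (hxy : x * y = A ^ 2) (hxy' : (1 - x) * (1 - y) = B ^ 2)
    (hz : 0 < z) (hzAB : z * (A + B) < 1) {u w : ℝ} (hu : 0 < u) (huw : u ≤ w * z)
    (hw0 : 0 < w) (hw1 : w ≤ 1) :
    ∑' s, appellTerm α β x y A B u s ≤
      w ^ (α + β + 1) * ∑' s, appellTerm α β x y A B z s := by
  have hAB := add_pos hA hB
  have huAB : u * (A + B) < 1 := by
    refine lt_of_le_of_lt ?_ hzAB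
    have : u ≤ z := huw.trans (mul_le_of_le_one_left hz.le hw1)
    gcongr
  rw [← tsum_mul_left]
  refine (summable_appellTerm hα hβ hA hB hx hy hxy hxy' hu huAB).tsum_le_tsum (fun s => ?_)
    ((summable_appellTerm hα hβ hA hB hx hy hxy hxy' hz hzAB).mul_left _)
  have hs : (0 : ℝ) ≤ s := s.cast_nonneg
  have h1 : (u / 2) ^ (α + β + 1 + 2 * s) ≤
      w ^ (α + β + 1) * (z / 2) ^ (α + β + 1 + 2 * s) := by
    calc (u / 2) ^ (α + β + 1 + 2 * s) ≤ (w * (z / 2)) ^ (α + β + 1 + 2 * s) := by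
          refine Real.rpow_le_rpow (by positivity) (by linarith) (by linarith)
      _ = w ^ (α + β + 1 + 2 * s) * (z / 2) ^ (α + β + 1 + 2 * s) :=
          Real.mul_rpow hw0.le (by positivity)
      _ ≤ _ := by
          refine mul_le_mul_of_nonneg_right ?_ (by positivity)
          exact Real.rpow_le_rpow_of_exponent_ge hw0 hw1 (by linarith)
  have h2 := watsonPart_nonneg (a := α + 1) (b := β + 1) (by linarith) (by linarith) hx hy s
  have h3 := Real.Gamma_pos_of_pos (show 0 < α + 1 + (β + 1) + 2 * s by linarith)
  have h4 := Real.rpow_pos_of_pos hA (α + 1 / 2)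
  have h5 := Real.rpow_pos_of_pos hB (β + 1 / 2)
  unfold appellTerm
  calc _ ≤ A ^ (α + 1 / 2) * B ^ (β + 1 / 2) *
        ((watsonPart (α + 1) (β + 1) y s).eval x * Real.Gamma (α + 1 + (β + 1) + 2 * s) *
        (w ^ (α + β + 1) * (z / 2) ^ (α + β + 1 + 2 * s))) := by gcongr
    _ = _ := by ring

end Appell

lemma jacobiPoissonTerm_eq {α β : ℝ} (hα : -1 / 2 ≤ α) (hβ : -1 / 2 < β) {θ φ : ℝ}
    (hθ : θ ∈ Set.Ioo 0 Real.pi) (hφ : φ ∈ Set.Ioo 0 Real.pi) (t : ℝ) (n : ℕ) :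
    jacobiPoissonTerm α β t θ φ n = Real.exp (-t) ^ ((α + β + 1) / 2) *
      (poissonCoeff (α + 1) (β + 1) ((1 - Real.cos θ) / 2) ((1 - Real.cos φ) / 2) n *
        Real.exp (-t) ^ n) := by
  have hn : (0 : ℝ) ≤ n := n.cast_nonneg
  have hcos : ∀ ψ ∈ Set.Ioo 0 Real.pi, Real.cos ψ ∈ Set.Ioo (-1 : ℝ) 1 := fun ψ hψ => by
    have h1 := Real.cos_lt_cos_of_nonneg_of_le_pi le_rfl hψ.2.le hψ.1
    have h2 := Real.cos_lt_cos_of_nonneg_of_le_pi hψ.1.le le_rfl hψ.2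
    simp at h1 h2
    exact ⟨h2, h1⟩
  have g1 := Real.Gamma_pos_of_pos (show 0 < (n : ℝ) + 1 by linarith)
  have g2 := Real.Gamma_pos_of_pos (show 0 < (n : ℝ) + α + β + 1 by linarith)
  have g3 := Real.Gamma_pos_of_pos (show 0 < (n : ℝ) + α + 1 by linarith)
  have g4 := Real.Gamma_pos_of_pos (show 0 < (n : ℝ) + β + 1 by linarith)
  have hN : jacobiNorm α β n * jacobiNorm α β n =
      (2 * (n : ℝ) + α + β + 1) * Real.Gamma ((n : ℝ) + 1) *
      Real.Gamma ((n : ℝ) + α + β + 1) /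
      (Real.Gamma ((n : ℝ) + α + 1) * Real.Gamma ((n : ℝ) + β + 1)) := by
    have : 0 ≤ 2 * (n : ℝ) + α + β + 1 := by linarith
    exact Real.mul_self_sqrt (by positivity)
  have hexp : Real.exp (-t * |(n : ℝ) + (α + β + 1) / 2|) =
      Real.exp (-t) ^ ((α + β + 1) / 2) * Real.exp (-t) ^ n := by
    rw [abs_of_nonneg (by linarith), ← Real.exp_mul, ← Real.exp_nat_mul, ← Real.exp_add]
    ring_nf
  have e1 : (n : ℝ) + (α + 1 + (β + 1) - 1) = n + α + β + 1 := by ring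
  have e2 : 2 * (n : ℝ) + (α + 1 + (β + 1) - 1) = 2 * n + α + β + 1 := by ring
  rw [jacobiPoissonTerm, trigJacobi, trigJacobi,
    jacobiP_eq_eval (by linarith) (by linarith) n (hcos θ hθ),
    jacobiP_eq_eval (by linarith) (by linarith) n (hcos φ hφ), hexp, poissonCoeff, e1, e2,
    ← add_assoc, ← add_assoc, ← hN]
  ring

/-- With `ρ = exp (-t/2)`, the prefactor is `tanh (t/2)` and the series variable is `1 / cosh
(t/2)`. -/
lemma weight_mul_tsum_poissonCoeff {α β x y A B : ℝ} (hα : -1 / 2 ≤ α) (hβ : -1 / 2 < β)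
    (hA : 0 < A) (hB : 0 < B) (hx : x ∈ Set.Icc (0 : ℝ) 1) (hy : y ∈ Set.Icc (0 : ℝ) 1)
    (hxy : x * y = A ^ 2) (hxy' : (1 - x) * (1 - y) = B ^ 2) (hAB : A + B ≤ 1)
    {ρ : ℝ} (hρ0 : 0 < ρ) (hρ1 : ρ < 1) :
    A ^ (α + 1 / 2) * B ^ (β + 1 / 2) * ((ρ ^ 2) ^ ((α + β + 1) / 2) *
      ∑' n, poissonCoeff (α + 1) (β + 1) x y n * (ρ ^ 2) ^ n) =
    (1 - ρ ^ 2) / (1 + ρ ^ 2) * ∑' s, appellTerm α β x y A B (2 * ρ / (1 + ρ ^ 2)) s := by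
  have h1 : 0 < 1 + ρ ^ 2 := by positivity
  have hz : 0 < ρ / (1 + ρ ^ 2) := by positivity
  rw [tsum_poissonCoeff_mul_pow (by linarith) (by linarith) (by linarith) hx hy
    (fun v hv => summable_watsonPart_mul_pow hα hβ.le hA hB hx hy hxy hxy' hAB hv)
    ⟨by positivity, by nlinarith⟩, ← tsum_mul_left, ← tsum_mul_left, ← tsum_mul_left,
    ← tsum_mul_left]
  refine tsum_congr fun s => ?_
  have e1 : (ρ ^ 2) ^ ((α + β + 1) / 2) = ρ ^ (α + β + 1) := by
    rw [← Real.rpow_natCast, ← Real.rpow_mul hρ0.le]; congr 1; push_cast; ring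
  have e2 : (1 + ρ ^ 2) ^ (-(α + 1 + (β + 1))) =
      ((1 + ρ ^ 2) ^ (α + β + 1))⁻¹ * (1 + ρ ^ 2)⁻¹ := by
    rw [← mul_inv, ← Real.rpow_add_one h1.ne', Real.rpow_neg h1.le]; congr 2; ring
  have e3 : (ρ / (1 + ρ ^ 2)) ^ (2 * (s : ℝ)) = (ρ ^ 2 / (1 + ρ ^ 2) ^ 2) ^ s := by
    rw [Real.rpow_mul hz.le, Real.rpow_two, Real.rpow_natCast, div_pow]
  have e4 : 2 * ρ / (1 + ρ ^ 2) / 2 = ρ / (1 + ρ ^ 2) := by ring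
  rw [appellTerm, e4, Real.rpow_add hz, e3, Real.div_rpow hρ0.le h1.le, e1, e2]
  ring

lemma one_sub_exp_neg_ge {u : ℝ} (hu0 : 0 ≤ u) (hu1 : u ≤ 1) : u / 2 ≤ 1 - Real.exp (-u) := by
  have h := Real.add_one_le_exp u
  have hp := Real.exp_pos u
  rw [Real.exp_neg, inv_eq_one_div]
  have h2 : 1 / Real.exp u ≤ 1 / (1 + u) := one_div_le_one_div_of_le (by linarith) (by linarith)
  have h3 : 1 / (1 + u) ≤ 1 - u / 2 := by
    rw [div_le_iff₀ (by linarith)]; nlinarith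
  linarith

/-- The Jacobi-Poisson kernel conjugated by the weights, in terms of `ρ = exp (-t / 2)`. -/
noncomputable def conjPoisson (α β x y A B ρ : ℝ) : ℝ :=
  (1 - ρ ^ 2) / (1 + ρ ^ 2) * ∑' s, appellTerm α β x y A B (2 * ρ / (1 + ρ ^ 2)) s

section ConjPoisson

variable {α β x y A B δ : ℝ}

lemma conjPoisson_nonneg (hα : -1 / 2 ≤ α) (hβ : -1 / 2 ≤ β) (hA : 0 < A) (hB : 0 < B)
    (hx : x ∈ Set.Icc (0 : ℝ) 1) (hy : y ∈ Set.Icc (0 : ℝ) 1) {ρ : ℝ} (h0 : 0 < ρ) (h1 : ρ < 1) :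
    0 ≤ conjPoisson α β x y A B ρ := by
  have : 0 ≤ 1 - ρ ^ 2 := by nlinarith
  exact mul_nonneg (by positivity)
    (tsum_nonneg (appellTerm_nonneg hα hβ hA hB hx hy (by positivity)))

lemma conjPoisson_le (hα : -1 / 2 ≤ α) (hβ : -1 / 2 ≤ β) (hA : 0 < A) (hB : 0 < B)
    (hx : x ∈ Set.Icc (0 : ℝ) 1) (hy : y ∈ Set.Icc (0 : ℝ) 1)
    (hxy : x * y = A ^ 2) (hxy' : (1 - x) * (1 - y) = B ^ 2) (hδ : 0 < δ)
    (hABδ : A + B = 1 - 2 * δ ^ 2) {ρ : ℝ} (h0 : 0 < ρ) (h1 : ρ < 1) :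
    conjPoisson α β x y A B ρ ≤ 4 * (1 - ρ) / ((1 - ρ) ^ 2 + 4 * ρ * δ ^ 2) := by
  have hp : 0 < 1 + ρ ^ 2 := by positivity
  have hD : 0 < (1 - ρ) ^ 2 + 4 * ρ * δ ^ 2 := by positivity
  -- This is where the distance `δ` enters: the gap `1 - z (A + B)` is the denominator of a
  -- classical Poisson kernel.
  have hzAB : 2 * ρ / (1 + ρ ^ 2) * (A + B) =
      1 - ((1 - ρ) ^ 2 + 4 * ρ * δ ^ 2) / (1 + ρ ^ 2) := by
    rw [hABδ]; field_simp; ring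
  have hlt : 2 * ρ / (1 + ρ ^ 2) * (A + B) < 1 := by
    rw [hzAB]; linarith [div_pos hD hp]
  have hle := tsum_appellTerm_le hα hβ hA hB hx hy hxy hxy'
    (show 0 < 2 * ρ / (1 + ρ ^ 2) by positivity) hlt
  have h2 : 0 ≤ 1 - ρ ^ 2 := by nlinarith
  calc _ ≤ (1 - ρ ^ 2) / (1 + ρ ^ 2) * (2 / (1 - 2 * ρ / (1 + ρ ^ 2) * (A + B))) :=
        mul_le_mul_of_nonneg_left hle (by positivity)
    _ = 2 * (1 - ρ ^ 2) / ((1 - ρ) ^ 2 + 4 * ρ * δ ^ 2) := by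
        rw [hzAB, sub_sub_cancel]; field_simp
    _ ≤ _ := by
        refine div_le_div_of_nonneg_right ?_ hD.le
        nlinarith

lemma conjPoisson_exp_le_mul (hα : -1 / 2 ≤ α) (hβ : -1 / 2 ≤ β) (hA : 0 < A) (hB : 0 < B)
    (hx : x ∈ Set.Icc (0 : ℝ) 1) (hy : y ∈ Set.Icc (0 : ℝ) 1)
    (hxy : x * y = A ^ 2) (hxy' : (1 - x) * (1 - y) = B ^ 2) (hδ : 0 < δ)
    (hABδ : A + B = 1 - 2 * δ ^ 2) {t : ℝ} (ht : 0 < t) (ht2 : t ≤ 2) :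
    conjPoisson α β x y A B (Real.exp (-(t / 2))) ≤ 2 * t / δ ^ 2 := by
  have h1 : Real.exp (-(t / 2)) < 1 := by rw [Real.exp_lt_one_iff]; linarith
  have h2 : 1 - Real.exp (-(t / 2)) ≤ t / 2 := by linarith [Real.add_one_le_exp (-(t / 2))]
  have h3 : 1 / 4 ≤ Real.exp (-(t / 2)) := by
    have e1 : Real.exp (-1) ≤ Real.exp (-(t / 2)) := Real.exp_le_exp.2 (by linarith)
    have e2 := Real.exp_neg_one_gt_d9
    linarith
  refine (conjPoisson_le hα hβ hA hB hx hy hxy hxy' hδ hABδ (Real.exp_pos _) h1).trans ?_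
  generalize Real.exp (-(t / 2)) = ρ at *
  have h5 : 0 < δ ^ 2 := by positivity
  have h6 : 0 < ρ := by linarith
  rw [div_le_div_iff₀ (by positivity) h5]
  calc 4 * (1 - ρ) * δ ^ 2 ≤ 2 * t * (4 * (1 / 4) * δ ^ 2) := by nlinarith
    _ ≤ 2 * t * ((1 - ρ) ^ 2 + 4 * ρ * δ ^ 2) := by
        refine mul_le_mul_of_nonneg_left ?_ (by positivity)
        nlinarith [sq_nonneg (1 - ρ)]

lemma conjPoisson_exp_le_div (hα : -1 / 2 ≤ α) (hβ : -1 / 2 ≤ β) (hA : 0 < A) (hB : 0 < B)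
    (hx : x ∈ Set.Icc (0 : ℝ) 1) (hy : y ∈ Set.Icc (0 : ℝ) 1)
    (hxy : x * y = A ^ 2) (hxy' : (1 - x) * (1 - y) = B ^ 2) (hδ : 0 < δ)
    (hABδ : A + B = 1 - 2 * δ ^ 2) {t : ℝ} (ht : 0 < t) (ht2 : t ≤ 2) :
    conjPoisson α β x y A B (Real.exp (-(t / 2))) ≤ 16 / t := by
  have h1 : Real.exp (-(t / 2)) < 1 := by rw [Real.exp_lt_one_iff]; linarith
  have h2 := one_sub_exp_neg_ge (show 0 ≤ t / 2 by linarith) (by linarith)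
  have h0 := Real.exp_pos (-(t / 2))
  refine (conjPoisson_le hα hβ hA hB hx hy hxy hxy' hδ hABδ h0 h1).trans ?_
  generalize Real.exp (-(t / 2)) = ρ at *
  rw [div_le_div_iff₀ (by positivity) ht]
  have h5 : 0 ≤ 4 * ρ * δ ^ 2 := by positivity
  nlinarith

lemma conjPoisson_exp_le_exp (hα : -1 / 2 ≤ α) (hβ : -1 / 2 ≤ β) (hA : 0 < A) (hB : 0 < B)
    (hx : x ∈ Set.Icc (0 : ℝ) 1) (hy : y ∈ Set.Icc (0 : ℝ) 1)
    (hxy : x * y = A ^ 2) (hxy' : (1 - x) * (1 - y) = B ^ 2)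
    (hAB : A + B ≤ 1) {t : ℝ} (ht : 2 < t) :
    conjPoisson α β x y A B (Real.exp (-(t / 2))) ≤
      8 * Real.exp (-((β + 1 / 2) * (t - 2) / 2)) := by
  set ρ := Real.exp (-(t / 2)) with hρ
  have h0 : 0 < ρ := Real.exp_pos _
  have h1 : ρ < 1 := by rw [hρ, Real.exp_lt_one_iff]; linarith
  have he := Real.exp_neg_one_lt_d9
  have hz0 : 0 < 2 * Real.exp (-1) := by positivity
  have hz1 : 2 * Real.exp (-1) ≤ 3 / 4 := by linarith
  have hz2 : 2 * Real.exp (-1) * (A + B) ≤ 3 / 4 := by nlinarith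
  -- The reference point `z = 2/e` dominates `2 ρ` at `t = 2`. There `z (A + B) ≤ 3/4`, which yields
  -- the constant `8` without any `δ`.
  have hle := tsum_appellTerm_le hα hβ hA hB hx hy hxy hxy' hz0 (by linarith)
  have h8 : 2 / (1 - 2 * Real.exp (-1) * (A + B)) ≤ 8 := by
    rw [div_le_iff₀ (by linarith)]; linarith
  have hu : 2 * ρ / (1 + ρ ^ 2) ≤ Real.exp (-((t - 2) / 2)) * (2 * Real.exp (-1)) := by
    have : Real.exp (-((t - 2) / 2)) * (2 * Real.exp (-1)) = 2 * ρ := by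
      rw [hρ, mul_left_comm, ← Real.exp_add]; ring_nf
    rw [this]
    exact div_le_self (by positivity) (by nlinarith)
  have hcmp := tsum_appellTerm_le_rpow_mul hα hβ hA hB hx hy hxy hxy' hz0 (by linarith)
    (show 0 < 2 * ρ / (1 + ρ ^ 2) by positivity) hu (Real.exp_pos _)
    (Real.exp_le_one_iff.2 (by linarith))
  have hpow : Real.exp (-((t - 2) / 2)) ^ (α + β + 1) ≤
      Real.exp (-((β + 1 / 2) * (t - 2) / 2)) := by
    -- Since `α ≥ -1/2`, the rate `α + β + 1` is at least `β + 1/2`.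
    rw [← Real.exp_mul, Real.exp_le_exp]; nlinarith
  have hsum0 : 0 ≤ ∑' s, appellTerm α β x y A B (2 * ρ / (1 + ρ ^ 2)) s :=
    tsum_nonneg (appellTerm_nonneg hα hβ hA hB hx hy (by positivity))
  have hτ : (1 - ρ ^ 2) / (1 + ρ ^ 2) ≤ 1 := by
    rw [div_le_one (by positivity)]; nlinarith
  calc _ ≤ ∑' s, appellTerm α β x y A B (2 * ρ / (1 + ρ ^ 2)) s :=
        mul_le_of_le_one_left hsum0 hτ
    _ ≤ _ := hcmp
    _ ≤ Real.exp (-((t - 2) / 2)) ^ (α + β + 1) * 8 :=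
        mul_le_mul_of_nonneg_left (hle.trans h8) (Real.rpow_nonneg (Real.exp_pos _).le _)
    _ ≤ Real.exp (-((β + 1 / 2) * (t - 2) / 2)) * 8 :=
        mul_le_mul_of_nonneg_right hpow (by norm_num)
    _ = _ := mul_comm _ _

end ConjPoisson

/-! ### Assembly in trigonometric variables -/

theorem theorem3 (σ : ℝ) (hσ0 : 0 < σ) (hσ1 : σ < 1) :
    ∃ C : ℝ, 0 < C ∧
      ∀ α β : ℝ, -1 / 2 ≤ α → -1 / 2 < β →
        ∀ θ ∈ Set.Ioo (0 : ℝ) Real.pi, ∀ φ ∈ Set.Ioo (0 : ℝ) Real.pi, θ ≠ φ →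
          (∀ t : ℝ, 0 < t → Summable (jacobiPoissonTerm α β t θ φ)) ∧
          MeasureTheory.IntegrableOn
            (fun t : ℝ => jacobiPoissonKernel α β t θ φ / t ^ (1 - σ)) (Set.Ioi 0) ∧
          0 ≤ jacobiFractionalKernel σ α β θ φ ∧
          jacobiFractionalKernel σ α β θ φ ≤
            C / ((Real.sin (θ / 2) * Real.sin (φ / 2)) ^ (α + 1 / 2) *
                (Real.cos (θ / 2) * Real.cos (φ / 2)) ^ (β + 1 / 2)) *
              (1 / (β + 1 / 2) + 1 / |Real.sin ((θ - φ) / 4)| ^ (1 - σ)) := by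
  obtain ⟨C, hC, hbound⟩ := exists_integral_div_rpow_le hσ0 hσ1
  have hΓ := Real.Gamma_pos_of_pos hσ0
  refine ⟨C / Real.Gamma σ, by positivity, ?_⟩
  intro α β hα hβ θ hθ φ hφ hne
  set A := Real.sin (θ / 2) * Real.sin (φ / 2) with hAdef
  set B := Real.cos (θ / 2) * Real.cos (φ / 2) with hBdef
  set δ := |Real.sin ((θ - φ) / 4)| with hδdef
  set x := (1 - Real.cos θ) / 2 with hxdef
  set y := (1 - Real.cos φ) / 2 with hydef
  have hA : 0 < A := mul_pos
    (Real.sin_pos_of_pos_of_lt_pi (by linarith [hθ.1]) (by linarith [hθ.2, hθ.1]))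
    (Real.sin_pos_of_pos_of_lt_pi (by linarith [hφ.1]) (by linarith [hφ.2, hφ.1]))
  have hB : 0 < B := mul_pos
    (Real.cos_pos_of_mem_Ioo ⟨by linarith [hθ.1, hθ.2], by linarith [hθ.2]⟩)
    (Real.cos_pos_of_mem_Ioo ⟨by linarith [hφ.1, hφ.2], by linarith [hφ.2]⟩)
  have hδ : 0 < δ := by
    rw [hδdef, abs_pos]
    intro h
    rw [Real.sin_eq_zero_iff_of_lt_of_lt (by linarith [hθ.1, hφ.2, Real.pi_pos])
      (by linarith [hθ.2, hφ.1, Real.pi_pos])] at h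
    exact hne (by linarith)
  have hx : x ∈ Set.Icc (0 : ℝ) 1 :=
    ⟨by linarith [Real.cos_le_one θ], by linarith [Real.neg_one_le_cos θ]⟩
  have hy : y ∈ Set.Icc (0 : ℝ) 1 :=
    ⟨by linarith [Real.cos_le_one φ], by linarith [Real.neg_one_le_cos φ]⟩
  have hsθ : Real.sin (θ / 2) ^ 2 = x := by
    rw [Real.sin_sq_eq_half_sub, hxdef]; ring_nf
  have hsφ : Real.sin (φ / 2) ^ 2 = y := by
    rw [Real.sin_sq_eq_half_sub, hydef]; ring_nf
  have hxy : x * y = A ^ 2 := by rw [← hsθ, ← hsφ]; ring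
  have hxy' : (1 - x) * (1 - y) = B ^ 2 := by
    rw [← hsθ, ← hsφ, ← Real.cos_sq', ← Real.cos_sq']; ring
  -- Addition formula for `cos (θ/2 - φ/2)`, then the half-angle formula.
  have hABδ : A + B = 1 - 2 * δ ^ 2 := by
    rw [hδdef, sq_abs, Real.sin_sq_eq_half_sub]
    have := Real.cos_sub (θ / 2) (φ / 2)
    have e : 2 * ((θ - φ) / 4) = θ / 2 - φ / 2 := by ring
    rw [e, this]; ring
  have hAB : A + B ≤ 1 := by rw [hABδ]; nlinarith
  set w := A ^ (α + 1 / 2) * B ^ (β + 1 / 2) with hw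
  have hw0 : 0 < w := mul_pos (Real.rpow_pos_of_pos hA _) (Real.rpow_pos_of_pos hB _)
  have hterm := jacobiPoissonTerm_eq hα hβ hθ hφ
  have hker : ∀ t, jacobiPoissonKernel α β t θ φ = Real.exp (-t) ^ ((α + β + 1) / 2) *
      ∑' n, poissonCoeff (α + 1) (β + 1) x y n * Real.exp (-t) ^ n := by
    intro t
    rw [jacobiPoissonKernel, tsum_congr (hterm t), tsum_mul_left]
  have hr : ∀ t : ℝ, 0 < t → Real.exp (-t) ∈ Set.Ioo (0 : ℝ) 1 := fun t ht =>
    ⟨Real.exp_pos _, by rw [Real.exp_lt_one_iff]; linarith⟩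
  have hsummable : ∀ r ∈ Set.Ioo (0 : ℝ) 1,
      Summable fun n => poissonCoeff (α + 1) (β + 1) x y n * r ^ n := fun r hr =>
    summable_poissonCoeff_mul_pow (by linarith) (by linarith) (by linarith) hx hy hr.1 hr.2
  have hcont : ContinuousOn (fun t => jacobiPoissonKernel α β t θ φ) (Set.Ioi 0) := by
    simp only [hker]
    have h1 : Continuous fun t : ℝ => Real.exp (-t) := by fun_prop
    refine ContinuousOn.mul ?_ ?_
    · exact (h1.rpow_const fun t => Or.inl (Real.exp_pos _).ne').continuousOn
    · exact (analyticOnNhd_tsum_mul_pow hsummable).continuousOn.comp h1.continuousOn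
        fun t ht => hr t ht
  set f : ℝ → ℝ := fun t => w * jacobiPoissonKernel α β t θ φ with hf
  have hmain : ∀ t, 0 < t → f t = conjPoisson α β x y A B (Real.exp (-(t / 2))) := by
    intro t ht
    have h1 := hr (t / 2) (by linarith)
    have h2 : Real.exp (-(t / 2)) ^ 2 = Real.exp (-t) := by
      rw [← Real.exp_nat_mul]; congr 1; push_cast; ring
    rw [conjPoisson, ← weight_mul_tsum_poissonCoeff hα hβ hA hB hx hy hxy hxy' hAB h1.1 h1.2, h2,
      ← hker]
  have hf0 : ∀ t, 0 < t → 0 ≤ f t := fun t ht => by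
    have h1 := hr (t / 2) (by linarith)
    rw [hmain t ht]
    exact conjPoisson_nonneg hα hβ.le hA hB hx hy h1.1 h1.2
  have hf1 : ∀ t, 0 < t → t ≤ 2 → f t ≤ 2 * t / δ ^ 2 := fun t ht ht2 => by
    rw [hmain t ht]
    exact conjPoisson_exp_le_mul hα hβ.le hA hB hx hy hxy hxy' hδ hABδ ht ht2
  have hf2 : ∀ t, 0 < t → t ≤ 2 → f t ≤ 16 / t := fun t ht ht2 => by
    rw [hmain t ht]
    exact conjPoisson_exp_le_div hα hβ.le hA hB hx hy hxy hxy' hδ hABδ ht ht2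
  have hf3 : ∀ t, 2 < t → f t ≤ 8 * Real.exp (-((β + 1 / 2) * (t - 2) / 2)) := fun t ht => by
    rw [hmain t (by linarith)]
    exact conjPoisson_exp_le_exp hα hβ.le hA hB hx hy hxy hxy' hAB ht
  obtain ⟨hint, hle⟩ := hbound f δ (β + 1 / 2) hδ (by linarith)
    (continuousOn_const.mul hcont) hf0 hf1 hf2 hf3
  have hfK : ∀ t, jacobiPoissonKernel α β t θ φ / t ^ (1 - σ) = w⁻¹ * (f t / t ^ (1 - σ)) := by
    intro t; simp only [hf]; field_simp
  refine ⟨fun t ht => ?_, ?_, ?_, ?_⟩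
  · exact ((hsummable _ (hr t ht)).mul_left _).congr fun n => (hterm t n).symm
  · simp only [hfK]
    exact hint.const_mul _
  · rw [jacobiFractionalKernel]
    refine mul_nonneg (by positivity) (setIntegral_nonneg measurableSet_Ioi fun t ht => ?_)
    rw [hfK]
    have := hf0 t ht
    have := Real.rpow_nonneg (le_of_lt (show (0 : ℝ) < t from ht)) (1 - σ)
    positivity
  · rw [jacobiFractionalKernel]
    simp only [hfK]
    rw [integral_const_mul]
    calc 1 / Real.Gamma σ * (w⁻¹ * ∫ t in Set.Ioi (0 : ℝ), f t / t ^ (1 - σ)) ≤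
        1 / Real.Gamma σ * (w⁻¹ * (C * (1 / (β + 1 / 2) + 1 / δ ^ (1 - σ)))) := by gcongr
      _ = _ := by ring
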